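/- Let $K$ be a field and let $S=K[x_1,\dots,x_n]$ with its standard grading. All modules are finitely generated graded $S$-modules, and all maps are homogeneous of degree $0$. Let $$E:\quad 0\to E^0\to E^1\to\cdots\to E^n\to 0$$ be a complex of graded free $S$-modules, and let $$F:\quad \cdots\to F_1\to F_0$$ be a graded free resolution of finite length, not necessarily minimal, of a graded $S$-module $M$. Write $F_i=\bigoplus_k S(-k)^{\beta_{i,k}}$ and $\gamma_{j,d}=\dim_K H^j(E)_d$, and put $$\langle F,E\rangle=\sum_{\{i,j,k\,\mid\, j\le i\}}(-1)^{i-j}\beta_{i,k}\,\gamma_{j,-k}.$$ For a graded module $N$, let $\operatorname{reg}N$ be its Castelnuovo–Mumford regularity, that is, the maximum of $k-i$ over all $i,k$ such that $S(-k)$ is a summand of the $i$-th term of the minimal free resolution of $N$, with $\operatorname{reg}0=-\infty$. Then $$\langle F,E\rangle=\sum_j\chi\bigl(F_{\ge j}\otimes_S H^j(E)\bigr),\qquad \chi\bigl(F_{\ge j}\otimes_S H^j(E)\bigr)=\sum_{k\ge j}(-1)^{k-j}\dim_K\bigl(F_k\otimes_S H^j(E)\bigr)_0,$$ and: 1. $\langle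 F,E\rangle\ge 0$. 2. Suppose in addition that $M$ and the modules $H^j(E)$ for $j>0$ have finite length. If $$\operatorname{reg}M+\operatorname{reg}E^0<0\qquad\text{and}\qquad \operatorname{reg}F_{j-1}+\operatorname{reg}H^j(E)<0\quad\text{for every } j>0,$$ then $\langle F,E\rangle=0$. -/

import Mathlib

open scoped TensorProduct

noncomputable section

namespace BoijSoderberg

universe u v w

/-- The polynomial ring `S = K[x_1, …, x_n]`. -/
abbrev Poly (K : Type u) [Field K] (n : ℕ) : Type u := MvPolynomial (Fin n) K

/-- The homogeneous maximal ideal `(x_1, …, x_n)` of `S`. -/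
def irrelevant (K : Type u) [Field K] (n : ℕ) : Ideal (Poly K n) :=
  Ideal.span (Set.range MvPolynomial.X)

/-- The degree `d` part of `S` (standard grading, `d` any integer). -/
def polyPiece (K : Type u) [Field K] (n : ℕ) (d : ℤ) : Submodule K (Poly K n) :=
  if 0 ≤ d then MvPolynomial.homogeneousSubmodule (Fin n) K d.toNat else ⊥

section Modules

variable {K : Type u} [Field K] {n : ℕ}
variable {M : Type v} [AddCommGroup M] [Module K M] [Module (Poly K n) M]
variable {N : Type w} [AddCommGroup N] [Module K N] [Module (Poly K n) N]

/-- `ℳ` is a `ℤ`-grading of the `S`-module `M`: `M` is the internal direct sum of the `ℳ d`, and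
`S_i • ℳ d ⊆ ℳ (i + d)`. -/
structure IsGrading (n : ℕ) [Module (Poly K n) M] (ℳ : ℤ → Submodule K M) : Prop where
  isInternal : DirectSum.IsInternal ℳ
  smul_mem : ∀ (i : ℕ) (d : ℤ) (p : Poly K n) (x : M),
    p ∈ MvPolynomial.homogeneousSubmodule (Fin n) K i → x ∈ ℳ d → p • x ∈ ℳ (i + d)

/-- The Hilbert function `h_d(M) = dim_K M_d`. -/
def hilbert (ℳ : ℤ → Submodule K M) (d : ℤ) : ℕ :=
  Module.finrank K (ℳ d)

/-- An `S`-linear map is homogeneous of degree zero. -/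
def IsHomogeneousMap (ℳ : ℤ → Submodule K M) (𝒩 : ℤ → Submodule K N)
    (f : M →ₗ[Poly K n] N) : Prop :=
  ∀ (d : ℤ) (x : M), x ∈ ℳ d → f x ∈ 𝒩 d

/-- The degree `d` part of the graded free module `⊕ₛ S(-a s)`, which is `ι → S` with the `s`-th
basis vector placed in degree `a s`. -/
def freePiece (K : Type u) [Field K] (n : ℕ) {ι : Type*} (a : ι → ℤ) (d : ℤ) :
    Submodule K (ι → Poly K n) :=
  Submodule.pi Set.univ fun s => polyPiece K n (d - a s)

/-- The degree `d` part of `M ⊗_S N`: the span of the `x ⊗ y` with `deg x + deg y = d`. -/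
def tensorPiece (n : ℕ) [Module (Poly K n) M] [Module (Poly K n) N]
    [SMulCommClass (Poly K n) K M]
    (ℳ : ℤ → Submodule K M) (𝒩 : ℤ → Submodule K N) (d : ℤ) :
    Submodule K (M ⊗[Poly K n] N) :=
  Submodule.span K {z | ∃ (a b : ℤ) (x : M) (y : N),
    a + b = d ∧ x ∈ ℳ a ∧ y ∈ 𝒩 b ∧ z = x ⊗ₜ[Poly K n] y}

/-- A (not necessarily minimal, not necessarily bounded) graded free resolution
`⋯ → F_1 → F_0 → M → 0`, where `F_i = ⊕ₛ S(-deg i s)` is a finitely generated graded free module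
and all maps are homogeneous of degree zero. -/
structure FreeResolution (n : ℕ) [Module (Poly K n) M] (ℳ : ℤ → Submodule K M) where
  rank : ℕ → ℕ
  deg : ∀ i, Fin (rank i) → ℤ
  d : ∀ i, (Fin (rank (i + 1)) → Poly K n) →ₗ[Poly K n] (Fin (rank i) → Poly K n)
  aug : (Fin (rank 0) → Poly K n) →ₗ[Poly K n] M
  d_homogeneous : ∀ i,
    IsHomogeneousMap (freePiece K n (deg (i + 1))) (freePiece K n (deg i)) (d i)
  aug_homogeneous : IsHomogeneousMap (freePiece K n (deg 0)) ℳ aug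
  exact : ∀ i, Function.Exact (d (i + 1)) (d i)
  exact_aug : Function.Exact (d 0) aug
  aug_surjective : Function.Surjective aug

namespace FreeResolution

variable {ℳ : ℤ → Submodule K M} (F : FreeResolution n ℳ)

/-- The grading of `F_i`. -/
def piece (i : ℕ) : ℤ → Submodule K (Fin (F.rank i) → Poly K n) :=
  freePiece K n (F.deg i)

/-- The Betti number `β_{i,k}(F)`: the number of summands `S(-k)` of `F_i`. -/
def betti (i : ℕ) (k : ℤ) : ℕ :=
  Fintype.card {s : Fin (F.rank i) // F.deg i s = k}

/-- `F` is minimal: its differentials have image in `(x_1, …, x_n) F`. -/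
def IsMinimal : Prop :=
  ∀ i, LinearMap.range (F.d i) ≤
    irrelevant K n • (⊤ : Submodule (Poly K n) (Fin (F.rank i) → Poly K n))

end FreeResolution

/-- The Castelnuovo–Mumford regularity of a finitely generated graded module `M`: the supremum of
`k - i` over all `i`, `k` with `β_{i,k} ≠ 0` in the minimal free resolution of `M` (which is unique
up to isomorphism). It is `-∞` for `M = 0`. -/
def regularity (n : ℕ) [Module (Poly K n) M] (ℳ : ℤ → Submodule K M) : EReal :=
  sSup {r : EReal | ∃ G : FreeResolution n ℳ, G.IsMinimal ∧
    ∃ (i : ℕ) (k : ℤ), G.betti i k ≠ 0 ∧ r = (((k - i : ℤ) : ℝ) : EReal)}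

end Modules

/-- A complex `E : 0 → E^0 → E^1 → ⋯` of finitely generated graded free `S`-modules
`E^i = ⊕ₛ S(-deg i s)`, with differentials homogeneous of degree zero. -/
structure FreeComplex (K : Type u) [Field K] (n : ℕ) where
  rank : ℕ → ℕ
  deg : ∀ i, Fin (rank i) → ℤ
  d : ∀ i, (Fin (rank i) → Poly K n) →ₗ[Poly K n] (Fin (rank (i + 1)) → Poly K n)
  d_homogeneous : ∀ i,
    IsHomogeneousMap (freePiece K n (deg i)) (freePiece K n (deg (i + 1))) (d i)
  d_comp_d : ∀ i, d (i + 1) ∘ₗ d i = 0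

namespace FreeComplex

variable {K : Type u} [Field K] {n : ℕ} (E : FreeComplex K n)

/-- The grading of `E^i`. -/
def piece (i : ℕ) : ℤ → Submodule K (Fin (E.rank i) → Poly K n) :=
  freePiece K n (E.deg i)

/-- The cocycles in `E^j`. -/
abbrev cocycles (j : ℕ) : Submodule (Poly K n) (Fin (E.rank j) → Poly K n) :=
  LinearMap.ker (E.d j)

/-- The coboundaries in `E^j` (zero for `j = 0`). -/
def coboundaries : ∀ j : ℕ, Submodule (Poly K n) (Fin (E.rank j) → Poly K n)
  | 0 => ⊥
  | j + 1 => LinearMap.range (E.d j)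

/-- The cohomology module `H^j(E)`. -/
abbrev H (j : ℕ) : Type u :=
  E.cocycles j ⧸ (E.coboundaries j).submoduleOf (E.cocycles j)

/-- The grading of `H^j(E)`: `H^j(E)_d` consists of the classes of cocycles of degree `d`. -/
def HPiece (j : ℕ) (d : ℤ) : Submodule K (E.H j) :=
  ((E.piece j d).comap ((E.cocycles j).subtype.restrictScalars K)).map
    (((E.coboundaries j).submoduleOf (E.cocycles j)).mkQ.restrictScalars K)

/-- The cohomology table `γ_{j,d}(E) = dim_K H^j(E)_d`. -/
def gamma (j : ℕ) (d : ℤ) : ℕ :=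
  hilbert (E.HPiece j) d

end FreeComplex

/-- `⟨β, γ⟩ = ∑_{j ≤ i, k} (-1)^{i-j} β_{i,k} γ_{j,-k}`, for tables for which the sum is finite. -/
def tablePairing (β γ : ℕ → ℤ → ℕ) : ℤ :=
  ∑ᶠ (j : ℕ) (i : ℕ) (k : ℤ),
    if j ≤ i then (-1 : ℤ) ^ (i - j) * (β i k : ℤ) * (γ j (-k) : ℤ) else 0

section Pairing

variable {K : Type u} [Field K] {n : ℕ}
variable {M : Type v} [AddCommGroup M] [Module K M] [Module (Poly K n) M]

/-- `⟨F, E⟩ = ⟨β(F), γ(E)⟩`. -/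
def pairing {ℳ : ℤ → Submodule K M} (F : FreeResolution n ℳ) (E : FreeComplex K n) : ℤ :=
  tablePairing F.betti E.gamma

/-- `χ(F_{≥ j} ⊗ H^j(E)) = ∑_{k ≥ j} (-1)^{k-j} dim_K (F_k ⊗_S H^j(E))_0`. -/
def truncatedEuler {ℳ : ℤ → Submodule K M} (F : FreeResolution n ℳ) (E : FreeComplex K n)
    (j : ℕ) : ℤ :=
  ∑ᶠ k : ℕ, if j ≤ k then
    (-1 : ℤ) ^ (k - j) * (hilbert (tensorPiece n (F.piece k) (E.HPiece j)) 0 : ℤ) else 0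

end Pairing

end BoijSoderberg

end

/-!
All terms are computed inside the double complex of finite-dimensional vector spaces
`A i j = (F_i ⊗ E^j)_0`. Its columns have cohomology `(F_i ⊗ H^j(E))_0`, of dimension
`∑ₖ β_{i,k} γ_{j,-k}`, because `F_i` is free; this already identifies `⟨F, E⟩` with the sum of the
truncated Euler characteristics (`hilbert_tensorPiece`, `tensorDouble_h`). Its rows are exact in
positions `i > 0`, because `E^j` is free.

*Nonnegativity.* Let `∂` and `δ` be the horizontal and vertical differentials. Rank–nullity and the
exactness of the rows collapse the alternating sum over `j ≤ i` to the diagonal: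
`⟨F, E⟩ = ∑ₚ (dim Zₚ - dim Bₚ)`, where `Zₚ = ker δ` in `A p p` and `Bₚ = ∂(A (p+1) p)`
(`DoubleComplex.sum_h_eq`). Put `Uₚ = δ(A p (p-1)) + ∂(A (p+1) p)`. Since `∂` and `δ` commute,
`∂ U_{p+1} = δ Uₚ`, so that `dim U_{p+1} = dim δ Uₚ + dim B_{p+1}` and the sum telescopes to
`⟨F, E⟩ = ∑ₚ dim (Zₚ / (Uₚ ∩ Zₚ)) ≥ 0` (`DoubleComplex.sum_h_eq_sum_diag`). This replaces the
spectral sequence of the double complex.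

*Vanishing.* It remains to see that `Zₚ ⊆ Uₚ`. A diagram chase by induction on `p`
(`DoubleComplex.mem_diag`) derives this from `(M ⊗ E^0)_0 = 0` and
`(F_{p-1} ⊗ H^p(E))_0 = 0` for `p > 0`. These follow from the hypotheses on the regularity once
it is known that a graded module `N` of finite length lives in degrees at most `reg N`
(`le_regularity_of_piece_ne_bot`). For the latter, a nonzero element of degree `d` has a nonzero
multiple in the socle, of degree `e ≥ d`. For a free resolution `G` of `N`, the connecting maps for
multiplication by `x_1, …, x_n` move the socle element to a nonzero class of degree `e + n` in
`H_n(G ⊗ S/(x_1, …, x_n))`, so `G_n` has a generator of degree `e + n`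
(`FreeResolution.betti_ne_zero_of_socle`). As the regularity is a supremum over minimal
resolutions, the existence of one is needed (`IsGrading.exists_minimal_resolution`): a homogeneous
generating set of smallest cardinality has its relations in `(x_1, …, x_n)`.
-/

noncomputable section

namespace BoijSoderberg

universe u v w

/-! ### A dimension count for double complexes -/

/-- Rank–nullity for the restriction of a linear map to a submodule of the ambient space. -/
lemma finrank_map_add_finrank_inf_ker {K V W : Type*} [Field K] [AddCommGroup V] [Module K V]
    [AddCommGroup W] [Module K W] (A : Submodule K V) [FiniteDimensional K A] (f : V →ₗ[K] W) :
    Module.finrank K (A.map f) + Module.finrank K ↥(A ⊓ LinearMap.ker f) = Module.finrank K A := by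
  have h := LinearMap.finrank_range_add_finrank_ker (f.domRestrict A)
  have h1 : LinearMap.range (f.domRestrict A) = A.map f := by
    rw [LinearMap.range_domRestrict]
  have h2 : (LinearMap.ker (f.domRestrict A)).map A.subtype = A ⊓ LinearMap.ker f := by
    ext x
    simp [LinearMap.mem_ker, and_comm]
  rw [h1] at h
  rw [← h2, LinearEquiv.finrank_eq
    (Submodule.equivMapOfInjective _ A.injective_subtype (LinearMap.ker (f.domRestrict A))).symm]
  exact h

lemma alternating_sum_telescope (f : ℕ → ℤ) (h0 : f 0 = 0) (i : ℕ) :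
    ∑ j ∈ Finset.range (i + 1), (-1 : ℤ) ^ (i - j) * (f (j + 1) + f j) = f (i + 1) := by
  induction i with
  | zero => simp [h0]
  | succ i ih =>
    rw [Finset.sum_range_succ]
    have : ∑ j ∈ Finset.range (i + 1), (-1 : ℤ) ^ (i + 1 - j) * (f (j + 1) + f j)
        = - ∑ j ∈ Finset.range (i + 1), (-1 : ℤ) ^ (i - j) * (f (j + 1) + f j) := by
      rw [← Finset.sum_neg_distrib]
      refine Finset.sum_congr rfl fun j hj => ?_
      have hj' : j ≤ i := by simpa [Nat.lt_succ_iff] using hj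
      rw [Nat.succ_sub hj', pow_succ]
      ring
    rw [this, ih]
    simp

/-- If `a i j` splits as `s i j + s (i - 1) j` for `i > 0`, the alternating sum of the `a i j` over
`j ≤ i ≤ L` telescopes in `i` to diagonal terms, up to a boundary term in the row `i = L`. -/
lemma alternating_sum_rows (a s : ℕ → ℕ → ℤ) (h : ∀ i j, a (i + 1) j = s (i + 1) j + s i j)
    (L : ℕ) :
    ∑ i ∈ Finset.range (L + 1), ∑ j ∈ Finset.range (i + 1), (-1 : ℤ) ^ (i - j) * a i j =
      ∑ j ∈ Finset.range (L + 1), (a j j - s j j) +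
        ∑ j ∈ Finset.range (L + 1), (-1 : ℤ) ^ (L - j) * s L j := by
  induction L with
  | zero => simp
  | succ L ih =>
    rw [Finset.sum_range_succ, ih, Finset.sum_range_succ _ (L + 1),
      Finset.sum_range_succ _ (L + 1), Finset.sum_range_succ _ (L + 1)]
    have : ∑ j ∈ Finset.range (L + 1), (-1 : ℤ) ^ (L + 1 - j) * a (L + 1) j
        = ∑ j ∈ Finset.range (L + 1), (-1 : ℤ) ^ (L + 1 - j) * s (L + 1) j
          - ∑ j ∈ Finset.range (L + 1), (-1 : ℤ) ^ (L - j) * s L j := by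
      rw [← Finset.sum_sub_distrib]
      refine Finset.sum_congr rfl fun j hj => ?_
      have hj' : j ≤ L := by simpa [Nat.lt_succ_iff] using hj
      rw [Nat.succ_sub hj', pow_succ, h]
      ring
    rw [this]
    simp
    ring

/-- A double complex of finite-dimensional vector spaces `A i j`, each given as a subspace of an
ambient space `X i j`, with commuting differentials `dh` (lowering `i`) and `dv` (raising `j`).
The rows `⋯ → A 1 j → A 0 j` are exact except at `A 0 j`. -/
structure DoubleComplex (K : Type u) [Field K] where
  X : ℕ → ℕ → Type v
  [acg : ∀ i j, AddCommGroup (X i j)]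
  [mod : ∀ i j, Module K (X i j)]
  A : ∀ i j, Submodule K (X i j)
  finite : ∀ i j, FiniteDimensional K (A i j)
  dh : ∀ i j, X (i + 1) j →ₗ[K] X i j
  dv : ∀ i j, X i j →ₗ[K] X i (j + 1)
  dh_mem : ∀ i j x, x ∈ A (i + 1) j → dh i j x ∈ A i j
  dv_mem : ∀ i j x, x ∈ A i j → dv i j x ∈ A i (j + 1)
  comm : ∀ i j x, dv i j (dh i j x) = dh i (j + 1) (dv (i + 1) j x)
  dv_dv : ∀ i j x, dv i (j + 1) (dv i j x) = 0
  dh_dh : ∀ i j x, dh i j (dh (i + 1) j x) = 0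
  exact : ∀ i j x, x ∈ A (i + 1) j → dh i j x = 0 → ∃ y ∈ A (i + 2) j, dh (i + 1) j y = x

namespace DoubleComplex

variable {K : Type u} [Field K] (D : DoubleComplex.{u, v} K)

attribute [instance] DoubleComplex.acg DoubleComplex.mod DoubleComplex.finite

/-- The vertical coboundaries in `A i j` (zero for `j = 0`). -/
def bound (i : ℕ) : ∀ j, Submodule K (D.X i j)
  | 0 => ⊥
  | j + 1 => (D.A i j).map (D.dv i j)

/-- The vertical cocycles in `A i j`. -/
def cyc (i j : ℕ) : Submodule K (D.X i j) := D.A i j ⊓ LinearMap.ker (D.dv i j)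

/-- The dimension of the vertical cohomology at `A i j`. -/
def h (i j : ℕ) : ℤ := Module.finrank K (D.cyc i j) - Module.finrank K (D.bound i j)

/-- The horizontal boundaries in `A i j`. -/
def hbound (i j : ℕ) : Submodule K (D.X i j) := (D.A (i + 1) j).map (D.dh i j)

/-- The subspace of `A p p` spanned by the vertical and the horizontal boundaries. -/
def diag (p : ℕ) : Submodule K (D.X p p) := D.bound p p ⊔ D.hbound p p

lemma hbound_le (i j : ℕ) : D.hbound i j ≤ D.A i j := by
  rintro _ ⟨x, hx, rfl⟩
  exact D.dh_mem _ _ _ hx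

lemma bound_le (i j : ℕ) : D.bound i j ≤ D.A i j := by
  cases j with
  | zero => exact bot_le
  | succ j =>
    rintro _ ⟨x, hx, rfl⟩
    exact D.dv_mem _ _ _ hx

lemma diag_le (p : ℕ) : D.diag p ≤ D.A p p := sup_le (D.bound_le p p) (D.hbound_le p p)

instance (p : ℕ) : FiniteDimensional K (D.diag p) :=
  Submodule.finiteDimensional_of_le (D.diag_le p)

instance (i j : ℕ) : FiniteDimensional K (D.cyc i j) :=
  Submodule.finiteDimensional_of_le (inf_le_left : D.cyc i j ≤ D.A i j)

/-- Exactness of the rows away from `A 0 j`. -/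
lemma inf_ker_dh (i j : ℕ) : D.A (i + 1) j ⊓ LinearMap.ker (D.dh i j) = D.hbound (i + 1) j := by
  ext x
  constructor
  · rintro ⟨hx, hx'⟩
    obtain ⟨y, hy, rfl⟩ := D.exact i j x hx hx'
    exact ⟨y, hy, rfl⟩
  · rintro ⟨y, hy, rfl⟩
    exact ⟨D.dh_mem _ _ _ hy, D.dh_dh _ _ _⟩

lemma finrank_A_succ (i j : ℕ) :
    (Module.finrank K (D.A (i + 1) j) : ℤ) =
      Module.finrank K (D.hbound (i + 1) j) + Module.finrank K (D.hbound i j) := by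
  have := finrank_map_add_finrank_inf_ker (D.A (i + 1) j) (D.dh i j)
  rw [inf_ker_dh] at this
  rw [← this]
  push_cast
  rw [hbound, hbound]
  ring

lemma finrank_A_eq (i j : ℕ) :
    (Module.finrank K (D.A i j) : ℤ) =
      Module.finrank K (D.bound i (j + 1)) + Module.finrank K (D.cyc i j) := by
  exact_mod_cast (finrank_map_add_finrank_inf_ker (D.A i j) (D.dv i j)).symm

/-- The truncated alternating sum of the vertical Betti numbers is concentrated on the diagonal. -/
lemma sum_h_eq (L : ℕ) (hL : ∀ j, D.A (L + 1) j = ⊥) :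
    ∑ i ∈ Finset.range (L + 1), ∑ j ∈ Finset.range (i + 1), (-1 : ℤ) ^ (i - j) * D.h i j =
      ∑ p ∈ Finset.range (L + 1),
        ((Module.finrank K (D.cyc p p) : ℤ) - Module.finrank K (D.hbound p p)) := by
  have h1 : ∀ i j, D.h i j = Module.finrank K (D.A i j) -
      (Module.finrank K (D.bound i (j + 1)) + Module.finrank K (D.bound i j)) := by
    intro i j
    rw [finrank_A_eq, h]
    ring
  have h2 := alternating_sum_rows (fun i j => (Module.finrank K (D.A i j) : ℤ))
    (fun i j => (Module.finrank K (D.hbound i j) : ℤ)) D.finrank_A_succ L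
  have h3 : ∀ j, Module.finrank K (D.hbound L j) = 0 := fun j => by
    rw [hbound, hL, Submodule.map_bot]
    exact finrank_bot K _
  have h4 : ∀ i, ∑ j ∈ Finset.range (i + 1), (-1 : ℤ) ^ (i - j) *
      ((Module.finrank K (D.bound i (j + 1)) : ℤ) + Module.finrank K (D.bound i j)) =
        Module.finrank K (D.bound i (i + 1)) := fun i =>
    alternating_sum_telescope (fun j => (Module.finrank K (D.bound i j) : ℤ))
      (by exact_mod_cast finrank_bot K (D.X i 0)) i
  simp only [h1, mul_sub, Finset.sum_sub_distrib, h4]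
  rw [h2]
  simp only [h3, Nat.cast_zero, mul_zero, Finset.sum_const_zero, add_zero]
  rw [← Finset.sum_sub_distrib, ← Finset.sum_sub_distrib]
  refine Finset.sum_congr rfl fun p _ => ?_
  rw [finrank_A_eq]
  ring

/-- The horizontal and the vertical differential send consecutive diagonal subspaces onto the same
subspace of `A p (p + 1)`; this is what makes the dimension count telescope. -/
lemma map_dh_diag_succ (p : ℕ) :
    (D.diag (p + 1)).map (D.dh p (p + 1)) = (D.diag p).map (D.dv p p) := by
  have e1 : (D.hbound (p + 1) (p + 1)).map (D.dh p (p + 1)) = ⊥ := by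
    rw [eq_bot_iff]
    rintro _ ⟨_, ⟨x, hx, rfl⟩, rfl⟩
    exact D.dh_dh _ _ _
  have e2 : (D.bound p p).map (D.dv p p) = ⊥ := by
    cases p with
    | zero => exact Submodule.map_bot _
    | succ p =>
      rw [eq_bot_iff]
      rintro _ ⟨_, ⟨x, hx, rfl⟩, rfl⟩
      exact D.dv_dv _ _ _
  rw [diag, diag, Submodule.map_sup, Submodule.map_sup, e1, e2, sup_bot_eq, bot_sup_eq, bound,
    hbound, ← Submodule.map_comp, ← Submodule.map_comp]
  congr 1
  ext x
  exact (D.comm _ _ _).symm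

lemma finrank_diag_zero :
    Module.finrank K (D.diag 0) = Module.finrank K (D.hbound 0 0) := by
  rw [diag, bound, bot_sup_eq]

lemma finrank_diag_succ (p : ℕ) :
    Module.finrank K (D.diag (p + 1)) =
      Module.finrank K ((D.diag p).map (D.dv p p)) + Module.finrank K (D.hbound (p + 1) (p + 1)) := by
  have : D.diag (p + 1) ⊓ LinearMap.ker (D.dh p (p + 1)) = D.hbound (p + 1) (p + 1) := by
    apply le_antisymm
    · rw [← inf_ker_dh]
      exact inf_le_inf_right _ (D.diag_le _)
    · refine le_inf le_sup_right ?_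
      rw [← inf_ker_dh]
      exact inf_le_right
  rw [← finrank_map_add_finrank_inf_ker (D.diag (p + 1)) (D.dh p (p + 1)), map_dh_diag_succ, this]

lemma sum_diag (L : ℕ) :
    ∑ p ∈ Finset.range (L + 1),
        ((Module.finrank K (D.cyc p p) : ℤ) - Module.finrank K (D.hbound p p)) =
      ∑ p ∈ Finset.range (L + 1), ((Module.finrank K (D.cyc p p) : ℤ) -
        Module.finrank K ↥(D.diag p ⊓ LinearMap.ker (D.dv p p)))
      - Module.finrank K ((D.diag L).map (D.dv L L)) := by
  have key : ∀ p, (Module.finrank K (D.diag p) : ℤ) = Module.finrank K ((D.diag p).map (D.dv p p))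
      + Module.finrank K ↥(D.diag p ⊓ LinearMap.ker (D.dv p p)) := fun p => by
    exact_mod_cast (finrank_map_add_finrank_inf_ker (D.diag p) (D.dv p p)).symm
  induction L with
  | zero =>
    have := key 0
    rw [finrank_diag_zero] at this
    simp only [zero_add, Finset.range_one, Finset.sum_singleton]
    linarith
  | succ L ih =>
    rw [Finset.sum_range_succ, ih, Finset.sum_range_succ _ (L + 1)]
    have := key (L + 1)
    rw [finrank_diag_succ] at this
    push_cast at this
    linarith

/-- The truncated alternating sum of the vertical Betti numbers counts the dimensions of the
vertical diagonal cocycles modulo those lying in the span of the boundaries. -/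
theorem sum_h_eq_sum_diag (L : ℕ) (hL : ∀ i, L < i + 1 → ∀ j, D.A i j = ⊥) :
    ∑ i ∈ Finset.range (L + 1), ∑ j ∈ Finset.range (i + 1), (-1 : ℤ) ^ (i - j) * D.h i j =
      ∑ p ∈ Finset.range (L + 1), ((Module.finrank K (D.cyc p p) : ℤ) -
        Module.finrank K ↥(D.diag p ⊓ LinearMap.ker (D.dv p p))) := by
  rw [D.sum_h_eq L (fun j => hL _ (by omega) j), D.sum_diag]
  have : D.diag L = ⊥ := by
    rw [eq_bot_iff, ← hL L (by omega) L]
    exact D.diag_le L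
  rw [this]
  simp

lemma diag_inf_ker_le (p : ℕ) : D.diag p ⊓ LinearMap.ker (D.dv p p) ≤ D.cyc p p :=
  inf_le_inf_right _ (D.diag_le p)

theorem sum_h_nonneg (L : ℕ) (hL : ∀ i, L < i + 1 → ∀ j, D.A i j = ⊥) :
    0 ≤ ∑ i ∈ Finset.range (L + 1), ∑ j ∈ Finset.range (i + 1), (-1 : ℤ) ^ (i - j) * D.h i j := by
  rw [D.sum_h_eq_sum_diag L hL]
  refine Finset.sum_nonneg fun p _ => sub_nonneg.2 ?_
  exact_mod_cast Submodule.finrank_mono (D.diag_inf_ker_le p)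

/-- If the row `j = 0` is also exact at `A 0 0` and the vertical cohomology vanishes at the places
`(p, p + 1)`, then a diagonal element whose vertical differential is a horizontal cycle lies in the
span of the boundaries. The condition is vacuous for `p = 0`, hence the form of `hx'`. -/
lemma mem_diag (h0 : D.A 0 0 ≤ D.hbound 0 0) (h1 : ∀ p, D.cyc p (p + 1) ≤ D.bound p (p + 1))
    (p : ℕ) (x : D.X p p) (hx : x ∈ D.A p p)
    (hx' : ∀ q (e : p = q + 1), D.dv q (q + 1) (D.dh q (q + 1) (e ▸ x)) = 0) : x ∈ D.diag p := by
  induction p with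
  | zero => exact le_sup_right (a := D.bound 0 0) (h0 hx)
  | succ p ih =>
    have hx1 := hx' p rfl
    obtain ⟨y, hy, hyx⟩ := h1 p ⟨D.dh_mem _ _ _ hx, hx1⟩
    have hyd : y ∈ D.diag p := by
      refine ih y hy fun q e => ?_
      subst e
      rw [D.comm]
      change D.dh _ _ (D.dv _ _ y) = 0
      rw [hyx]
      exact D.dh_dh _ _ _
    have : D.dh p (p + 1) x ∈ (D.diag (p + 1)).map (D.dh p (p + 1)) := by
      rw [map_dh_diag_succ]
      exact ⟨y, hyd, hyx⟩
    obtain ⟨z, hz, hzx⟩ := this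
    have hker : x - z ∈ D.hbound (p + 1) (p + 1) := by
      rw [← inf_ker_dh]
      refine ⟨sub_mem hx (D.diag_le _ hz), ?_⟩
      simp [hzx]
    have h2 : x - z ∈ D.diag (p + 1) := le_sup_right (a := D.bound (p + 1) (p + 1)) hker
    simpa using add_mem h2 hz

theorem sum_h_eq_zero (L : ℕ) (hL : ∀ i, L < i + 1 → ∀ j, D.A i j = ⊥)
    (h0 : D.A 0 0 ≤ D.hbound 0 0) (h1 : ∀ p, D.cyc p (p + 1) ≤ D.bound p (p + 1)) :
    ∑ i ∈ Finset.range (L + 1), ∑ j ∈ Finset.range (i + 1), (-1 : ℤ) ^ (i - j) * D.h i j = 0 := by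
  rw [D.sum_h_eq_sum_diag L hL]
  refine Finset.sum_eq_zero fun p _ => ?_
  have : D.diag p ⊓ LinearMap.ker (D.dv p p) = D.cyc p p := by
    refine le_antisymm (D.diag_inf_ker_le p) fun x hx => ⟨?_, hx.2⟩
    refine D.mem_diag h0 h1 p x hx.1 fun q e => ?_
    subst e
    rw [D.comm]
    change D.dh _ _ (D.dv _ _ x) = 0
    rw [show D.dv _ _ x = 0 from hx.2, map_zero]
  rw [this, sub_self]

end DoubleComplex

/-! ### Gradings and their projections -/

section Gradings

variable {K : Type u} [Field K] {n : ℕ}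
variable {M : Type v} [AddCommGroup M] [Module K M] [Module (Poly K n) M]
variable {N : Type w} [AddCommGroup N] [Module K N] [Module (Poly K n) N]
variable {ℳ : ℤ → Submodule K M} {𝒩 : ℤ → Submodule K N}

lemma isInternal_of_forall (htop : ⨆ d, ℳ d = ⊤)
    (hind : ∀ (t : Finset ℤ) (v : ℤ → M), (∀ d ∈ t, v d ∈ ℳ d) → ∑ d ∈ t, v d = 0 →
      ∀ d ∈ t, v d = 0) : DirectSum.IsInternal ℳ :=
  DirectSum.isInternal_submodule_of_iSupIndep_of_iSup_eq_top
    ((iSupIndep_iff_finsetSum_eq_zero_imp_eq_zero ℳ).2 hind) htop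

/-- The degree `d` part of a polynomial, `d` any integer (zero for `d < 0`). -/
def polyComp (K : Type u) [Field K] (n : ℕ) (d : ℤ) : Poly K n →ₗ[K] Poly K n :=
  if 0 ≤ d then MvPolynomial.homogeneousComponent d.toNat else 0

lemma polyComp_natCast (i : ℕ) (p : Poly K n) :
    polyComp K n i p = MvPolynomial.homogeneousComponent i p := by
  simp [polyComp]

lemma polyPiece_natCast (i : ℕ) :
    polyPiece K n i = MvPolynomial.homogeneousSubmodule (Fin n) K i := by
  simp [polyPiece]

lemma polyPiece_of_neg {d : ℤ} (hd : d < 0) : polyPiece K n d = ⊥ := by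
  simp [polyPiece, not_le.2 hd]

lemma polyComp_of_mem {d : ℤ} {p : Poly K n} (hp : p ∈ polyPiece K n d) :
    polyComp K n d p = p := by
  rcases le_or_gt 0 d with h | h
  · lift d to ℕ using h
    rw [polyPiece_natCast] at hp
    rw [polyComp_natCast, MvPolynomial.homogeneousComponent_of_mem hp, if_pos rfl]
  · rw [polyPiece_of_neg h, Submodule.mem_bot] at hp
    rw [hp, map_zero]

lemma polyComp_of_mem_of_ne {d e : ℤ} {p : Poly K n} (hp : p ∈ polyPiece K n d) (h : e ≠ d) :
    polyComp K n e p = 0 := by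
  rcases le_or_gt 0 d with hd | hd
  · rcases le_or_gt 0 e with he | he
    · lift d to ℕ using hd
      lift e to ℕ using he
      rw [polyPiece_natCast] at hp
      rw [polyComp_natCast, MvPolynomial.homogeneousComponent_of_mem hp, if_neg (by exact_mod_cast h)]
    · simp [polyComp, not_le.2 he]
  · rw [polyPiece_of_neg hd, Submodule.mem_bot] at hp
    rw [hp, map_zero]

lemma mul_mem_polyPiece {d e : ℤ} {p q : Poly K n} (hp : p ∈ polyPiece K n d)
    (hq : q ∈ polyPiece K n e) : p * q ∈ polyPiece K n (d + e) := by
  rcases le_or_gt 0 d with hd | hd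
  · rcases le_or_gt 0 e with he | he
    · lift d to ℕ using hd
      lift e to ℕ using he
      rw [polyPiece_natCast] at hp hq
      rw [← Nat.cast_add, polyPiece_natCast]
      exact MvPolynomial.IsHomogeneous.mul hp hq
    · rw [polyPiece_of_neg he, Submodule.mem_bot] at hq
      simp [hq]
  · rw [polyPiece_of_neg hd, Submodule.mem_bot] at hp
    simp [hp]

lemma one_mem_polyPiece : (1 : Poly K n) ∈ polyPiece K n 0 := by
  have := polyPiece_natCast (K := K) (n := n) 0
  rw [Nat.cast_zero] at this
  rw [this]
  exact MvPolynomial.isHomogeneous_one (Fin n) K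

instance (d : ℤ) : FiniteDimensional K (polyPiece K n d) := by
  rcases le_or_gt 0 d with hd | hd
  · lift d to ℕ using hd
    rw [polyPiece_natCast]
    exact Module.Finite.iff_fg.2 (MvPolynomial.homogeneousSubmodule_fg (Fin n) K d)
  · rw [polyPiece_of_neg hd]
    infer_instance

lemma mem_freePiece {ι : Type*} {a : ι → ℤ} {d : ℤ} {x : ι → Poly K n} :
    x ∈ freePiece K n a d ↔ ∀ s, x s ∈ polyPiece K n (d - a s) := by
  simp [freePiece, Submodule.mem_pi]

lemma single_mem_freePiece {ι : Type*} [DecidableEq ι] {a : ι → ℤ} {d : ℤ} {s : ι} {p : Poly K n}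
    (hp : p ∈ polyPiece K n (d - a s)) : Pi.single s p ∈ freePiece K n a d := by
  rw [mem_freePiece]
  intro t
  rcases eq_or_ne t s with rfl | h
  · simpa using hp
  · rw [Pi.single_eq_of_ne h]
    exact zero_mem _

theorem isGrading_freePiece {ι : Type*} [Finite ι] (a : ι → ℤ) :
    IsGrading n (freePiece K n a) where
  isInternal := by
    classical
    cases nonempty_fintype ι
    refine isInternal_of_forall ?_ ?_
    · rw [eq_top_iff]
      rintro x -
      rw [← Finset.univ_sum_single x]
      refine Submodule.sum_mem _ fun s _ => ?_
      rw [← MvPolynomial.sum_homogeneousComponent (x s)]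
      rw [← LinearMap.single_apply (R := K), map_sum]
      refine Submodule.sum_mem _ fun i _ => ?_
      refine Submodule.mem_iSup_of_mem (i + a s) (single_mem_freePiece ?_)
      rw [add_sub_cancel_right, polyPiece_natCast]
      exact MvPolynomial.homogeneousComponent_mem _ _
    · intro t v hv h0 d hd
      ext1 s
      have h1 := congrArg (fun x => polyComp K n (d - a s) (x s)) h0
      simp only [Finset.sum_apply, map_sum] at h1
      rw [Finset.sum_eq_single_of_mem d hd,
        polyComp_of_mem (mem_freePiece.1 (hv d hd) s)] at h1
      · simpa using h1
      · intro e he hne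
        exact polyComp_of_mem_of_ne (mem_freePiece.1 (hv e he) s) (by omega)
  smul_mem i d p x hp hx := by
    rw [mem_freePiece] at hx ⊢
    intro s
    rw [← polyPiece_natCast] at hp
    rw [Pi.smul_apply, smul_eq_mul, add_sub_assoc]
    exact mul_mem_polyPiece hp (hx s)

instance {ι : Type*} [Finite ι] (a : ι → ℤ) (d : ℤ) : FiniteDimensional K (freePiece K n a d) := by
  cases nonempty_fintype ι
  let f : freePiece K n a d →ₗ[K] ∀ s, polyPiece K n (d - a s) :=
    LinearMap.pi fun s => (LinearMap.proj s ∘ₗ (freePiece K n a d).subtype).codRestrict _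
      fun x => mem_freePiece.1 x.2 s
  refine FiniteDimensional.of_injective f fun x y hxy => ?_
  ext1
  funext s
  exact congrArg Subtype.val (congrFun hxy s)

namespace IsGrading

/-- The projection of a graded module onto its degree `d` part. -/
def proj (h : IsGrading n ℳ) (d : ℤ) : M →ₗ[K] M :=
  (ℳ d).subtype ∘ₗ DirectSum.component K ℤ (fun d => ℳ d) d ∘ₗ
    (LinearEquiv.ofBijective (DirectSum.coeLinearMap ℳ) h.isInternal).symm.toLinearMap

lemma proj_mem (h : IsGrading n ℳ) (d : ℤ) (x : M) : h.proj d x ∈ ℳ d :=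
  Subtype.prop _

lemma proj_of_mem (h : IsGrading n ℳ) {d : ℤ} {x : M} (hx : x ∈ ℳ d) : h.proj d x = x := by
  exact congrArg Subtype.val (h.isInternal.ofBijective_coeLinearMap_of_mem hx)

lemma proj_of_mem_of_ne (h : IsGrading n ℳ) {d e : ℤ} {x : M} (hx : x ∈ ℳ d) (hne : d ≠ e) :
    h.proj e x = 0 := by
  exact congrArg Subtype.val (h.isInternal.ofBijective_coeLinearMap_of_mem_ne hne hx)

lemma induction (h : IsGrading n ℳ) {p : M → Prop} (x : M) (hom : ∀ d, ∀ x ∈ ℳ d, p x)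
    (add : ∀ x y, p x → p y → p (x + y)) : p x := by
  have hx : x ∈ ⨆ d, ℳ d := by
    rw [h.isInternal.submodule_iSup_eq_top]
    trivial
  exact Submodule.iSup_induction ℳ (motive := p) hx hom (hom 0 0 (zero_mem _)) add

lemma map_proj (h : IsGrading n ℳ) (h' : IsGrading n 𝒩) {f : M →ₗ[Poly K n] N}
    (hf : IsHomogeneousMap ℳ 𝒩 f) (d : ℤ) (x : M) : f (h.proj d x) = h'.proj d (f x) := by
  induction x using h.induction with
  | hom e x hx =>
    rcases eq_or_ne e d with rfl | hne
    · rw [h.proj_of_mem hx, h'.proj_of_mem (hf _ _ hx)]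
    · rw [h.proj_of_mem_of_ne hx hne, h'.proj_of_mem_of_ne (hf _ _ hx) hne, map_zero]
  | add x y hx hy => simp only [map_add, hx, hy]

/-- On multiples `p • x` of a homogeneous element the projections act through the homogeneous parts
of `p`. -/
lemma proj_smul (h : IsGrading n ℳ) {e : ℤ} {x : M} (hx : x ∈ ℳ e) (d : ℤ) (p : Poly K n) :
    h.proj d (p • x) = polyComp K n (d - e) p • x := by
  conv_lhs => rw [← MvPolynomial.sum_homogeneousComponent p]
  conv_rhs => rw [← MvPolynomial.sum_homogeneousComponent p]
  simp only [Finset.sum_smul, map_sum]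
  refine Finset.sum_congr rfl fun i _ => ?_
  have h1 : MvPolynomial.homogeneousComponent i p ∈ MvPolynomial.homogeneousSubmodule (Fin n) K i :=
    MvPolynomial.homogeneousComponent_mem i p
  have h2 := h.smul_mem i e _ x h1 hx
  rw [← polyPiece_natCast] at h1
  rcases eq_or_ne (i + e : ℤ) d with hd | hd
  · subst hd
    rw [h.proj_of_mem h2, add_sub_cancel_right, polyComp_of_mem h1]
  · rw [h.proj_of_mem_of_ne h2 hd, polyComp_of_mem_of_ne h1 (by omega), zero_smul]

lemma exists_sum_proj (h : IsGrading n ℳ) (x : M) : ∃ t : Finset ℤ, ∑ d ∈ t, h.proj d x = x := by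
  have hx : x ∈ ⨆ d, ℳ d := by
    rw [h.isInternal.submodule_iSup_eq_top]
    trivial
  obtain ⟨f, hf, rfl⟩ := (Submodule.mem_iSup_iff_exists_finsupp ..).1 hx
  refine ⟨f.support, Finset.sum_congr rfl fun d hd => ?_⟩
  rw [Finsupp.sum, map_sum, Finset.sum_eq_single_of_mem d hd, h.proj_of_mem (hf d)]
  intro e _ hne
  exact h.proj_of_mem_of_ne (hf e) hne

/-- A submodule is homogeneous if it contains the homogeneous parts of its elements. -/
def IsHomogeneous (h : IsGrading n ℳ) (Z : Submodule (Poly K n) M) : Prop :=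
  ∀ x ∈ Z, ∀ d, h.proj d x ∈ Z

lemma isHomogeneous_top (h : IsGrading n ℳ) : h.IsHomogeneous ⊤ := fun _ _ _ => trivial

lemma isHomogeneous_bot (h : IsGrading n ℳ) : h.IsHomogeneous ⊥ := fun x hx d => by
  rw [Submodule.mem_bot] at hx
  simp [hx]

lemma isHomogeneous_ker (h : IsGrading n ℳ) (h' : IsGrading n 𝒩) {f : M →ₗ[Poly K n] N}
    (hf : IsHomogeneousMap ℳ 𝒩 f) : h.IsHomogeneous (LinearMap.ker f) := fun x hx d => by
  rw [LinearMap.mem_ker] at hx ⊢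
  rw [h.map_proj h' hf, hx, map_zero]

lemma isHomogeneous_range (h : IsGrading n ℳ) (h' : IsGrading n 𝒩) {f : M →ₗ[Poly K n] N}
    (hf : IsHomogeneousMap ℳ 𝒩 f) : h'.IsHomogeneous (LinearMap.range f) := by
  rintro _ ⟨x, rfl⟩ d
  exact ⟨h.proj d x, h.map_proj h' hf d x⟩

lemma exists_mem_of_mem_range (h : IsGrading n ℳ) (h' : IsGrading n 𝒩) {f : M →ₗ[Poly K n] N}
    (hf : IsHomogeneousMap ℳ 𝒩 f) {d : ℤ} {y : N} (hy : y ∈ LinearMap.range f) (hyd : y ∈ 𝒩 d) :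
    ∃ x ∈ ℳ d, f x = y := by
  obtain ⟨x, rfl⟩ := hy
  exact ⟨h.proj d x, h.proj_mem d x, by rw [h.map_proj h' hf, h'.proj_of_mem hyd]⟩

variable [IsScalarTower K (Poly K n) M]

theorem submodule (h : IsGrading n ℳ) {Z : Submodule (Poly K n) M} (hZ : h.IsHomogeneous Z) :
    IsGrading n (fun d => (ℳ d).comap (Z.subtype.restrictScalars K)) where
  isInternal := by
    refine isInternal_of_forall ?_ ?_
    · rw [eq_top_iff]
      rintro x -
      obtain ⟨t, ht⟩ := h.exists_sum_proj (x : M)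
      have : x = ∑ d ∈ t, (⟨h.proj d x, hZ x x.2 d⟩ : Z) := by
        ext1
        rw [AddSubmonoidClass.coe_finsetSum]
        exact ht.symm
      rw [this]
      exact Submodule.sum_mem _ fun d _ => Submodule.mem_iSup_of_mem d (h.proj_mem d x)
    · intro t v hv h0 d hd
      have h1 := congrArg (fun x : Z => (x : M)) h0
      simp only [AddSubmonoidClass.coe_finsetSum, ZeroMemClass.coe_zero] at h1
      ext1
      exact (iSupIndep_iff_finsetSum_eq_zero_imp_eq_zero ℳ).1 h.isInternal.submodule_iSupIndep t
        (fun d => (v d : M)) hv h1 d hd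
  smul_mem i d p x hp hx := h.smul_mem i d p x hp hx

theorem quotient (h : IsGrading n ℳ) {B : Submodule (Poly K n) M} (hB : h.IsHomogeneous B) :
    IsGrading n (fun d => (ℳ d).map (B.mkQ.restrictScalars K)) where
  isInternal := by
    refine isInternal_of_forall ?_ ?_
    · rw [← Submodule.map_iSup, h.isInternal.submodule_iSup_eq_top, eq_top_iff]
      rintro x -
      obtain ⟨y, rfl⟩ := B.mkQ_surjective x
      exact ⟨y, trivial, rfl⟩
    · intro t v hv h0 d hd
      choose! w hw hwv using hv
      have h1 : ∑ d ∈ t, w d ∈ B := by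
        rw [← Submodule.ker_mkQ B, LinearMap.mem_ker, map_sum, ← h0]
        exact Finset.sum_congr rfl fun d hd => hwv d hd
      have h2 := hB _ h1 d
      rw [map_sum, Finset.sum_eq_single_of_mem d hd, h.proj_of_mem (hw d hd)] at h2
      · rw [← hwv d hd]
        exact (Submodule.Quotient.mk_eq_zero B).2 h2
      · intro e he hne
        exact h.proj_of_mem_of_ne (hw e he) hne
  smul_mem i d p x hp hx := by
    obtain ⟨y, hy, rfl⟩ := hx
    exact ⟨p • y, h.smul_mem i d p y hp hy, map_smul B.mkQ p y⟩

end IsGrading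

end Gradings

/-! ### Existence of minimal graded free resolutions -/

section Minimal

variable {K : Type u} [Field K] {n : ℕ}
variable {M : Type v} [AddCommGroup M] [Module K M] [Module (Poly K n) M]
variable {ℳ : ℤ → Submodule K M}

lemma mem_irrelevant_of_coeff_zero {p : Poly K n} (hp : MvPolynomial.coeff 0 p = 0) :
    p ∈ irrelevant K n := by
  rw [irrelevant, ← Set.image_univ, MvPolynomial.mem_ideal_span_X_image]
  intro m hm
  by_contra! hcon
  have : m = 0 := Finsupp.ext fun i => hcon i trivial
  rw [MvPolynomial.mem_support_iff, this] at hm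
  exact hm hp

lemma mem_smul_top_of_forall {r : ℕ} {I : Ideal (Poly K n)} {x : Fin r → Poly K n}
    (hx : ∀ s, x s ∈ I) : x ∈ I • (⊤ : Submodule (Poly K n) (Fin r → Poly K n)) := by
  rw [pi_eq_sum_univ x]
  exact Submodule.sum_mem _ fun s _ => Submodule.smul_mem_smul (hx s) trivial

lemma IsGrading.exists_homogeneous_generators (h : IsGrading n ℳ) {Z : Submodule (Poly K n) M}
    (hZ : h.IsHomogeneous Z) (hfg : Z.FG) :
    ∃ (r : ℕ) (a : Fin r → ℤ) (g : Fin r → M),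
      (∀ s, g s ∈ ℳ (a s)) ∧ Submodule.span (Poly K n) (Set.range g) = Z := by
  have hspan : Submodule.span (Poly K n) {x | x ∈ Z ∧ ∃ d, x ∈ ℳ d} = Z := by
    apply le_antisymm
    · rw [Submodule.span_le]
      exact fun x hx => hx.1
    · intro x hx
      obtain ⟨t, ht⟩ := h.exists_sum_proj x
      rw [← ht]
      exact Submodule.sum_mem _ fun d _ =>
        Submodule.subset_span ⟨hZ x hx d, d, h.proj_mem d x⟩
  rw [← hspan] at hfg
  obtain ⟨t, ht, ht'⟩ := (Submodule.fg_span_iff_fg_span_finset_subset _).1 hfg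
  have h1 : ∀ s : Fin t.card, ∃ d, (t.equivFin.symm s : M) ∈ ℳ d := fun s =>
    (ht (t.equivFin.symm s).2).2
  choose a ha using h1
  refine ⟨t.card, a, fun s => t.equivFin.symm s, ha, ?_⟩
  rw [← hspan, ht']
  congr 1
  ext x
  constructor
  · rintro ⟨s, rfl⟩
    exact (t.equivFin.symm s).2
  · intro hx
    exact ⟨t.equivFin ⟨x, hx⟩, by simp⟩

/-- A smallest possible homogeneous generating set has all its relations in `(x_1, …, x_n)`: the
degree part of a relation with a unit coefficient would express one generator by the others. -/
theorem IsGrading.exists_minimal_cover (h : IsGrading n ℳ) {Z : Submodule (Poly K n) M}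
    (hZ : h.IsHomogeneous Z) (hfg : Z.FG) :
    ∃ (r : ℕ) (a : Fin r → ℤ) (f : (Fin r → Poly K n) →ₗ[Poly K n] M),
      IsHomogeneousMap (freePiece K n a) ℳ f ∧ LinearMap.range f = Z ∧
      LinearMap.ker f ≤ irrelevant K n • (⊤ : Submodule (Poly K n) (Fin r → Poly K n)) := by
  classical
  have hex := h.exists_homogeneous_generators hZ hfg
  obtain ⟨a, g, hg, hspan⟩ := Nat.find_spec hex
  have hmin := fun r => Nat.find_min hex (m := r)
  generalize Nat.find hex = r at a g hg hspan hmin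
  refine ⟨r, a, Fintype.linearCombination (Poly K n) g, ?_, ?_, ?_⟩
  · intro d x hx
    rw [mem_freePiece] at hx
    rw [Fintype.linearCombination_apply]
    refine Submodule.sum_mem _ fun s _ => ?_
    have := h.proj_smul (hg s) d (x s)
    rw [polyComp_of_mem (hx s)] at this
    rw [← this]
    exact h.proj_mem _ _
  · rw [Fintype.range_linearCombination, hspan]
  · intro c hc
    refine mem_smul_top_of_forall fun s => mem_irrelevant_of_coeff_zero ?_
    by_contra hk
    rw [LinearMap.mem_ker, Fintype.linearCombination_apply] at hc
    obtain _ | r := r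
    · exact s.elim0
    have h1 := congrArg (h.proj (a s)) hc
    rw [map_zero, map_sum, Fin.sum_univ_succAbove _ s] at h1
    simp only [h.proj_smul (hg _)] at h1
    rw [sub_self, show (0 : ℤ) = (0 : ℕ) from rfl, polyComp_natCast,
      MvPolynomial.homogeneousComponent_zero] at h1
    have h2 : (MvPolynomial.C (MvPolynomial.coeff 0 (c s)) : Poly K n) • g s ∈
        Submodule.span (Poly K n) (Set.range (g ∘ s.succAbove)) := by
      rw [eq_neg_of_add_eq_zero_left h1]
      exact neg_mem (Submodule.sum_mem _ fun t _ =>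
        Submodule.smul_mem _ _ (Submodule.subset_span ⟨t, rfl⟩))
    have h3 : g s ∈ Submodule.span (Poly K n) (Set.range (g ∘ s.succAbove)) := by
      have := Submodule.smul_mem _ (MvPolynomial.C (MvPolynomial.coeff 0 (c s))⁻¹) h2
      rwa [smul_smul, ← map_mul, inv_mul_cancel₀ hk, map_one, one_smul] at this
    refine hmin r (Nat.lt_succ_self r) ⟨a ∘ s.succAbove, g ∘ s.succAbove, fun t => hg _, ?_⟩
    rw [← hspan]
    apply le_antisymm
    · exact Submodule.span_mono (Set.range_comp_subset_range _ _)
    · rw [Submodule.span_le]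
      rintro _ ⟨t, rfl⟩
      rcases Fin.eq_self_or_eq_succAbove s t with rfl | ⟨j, rfl⟩
      · exact h3
      · exact Submodule.subset_span ⟨j, rfl⟩

/-- A homogeneous submodule `Z` of a graded free module `⊕ₛ S(-a s)`: the kernel reached at one
step in the construction of a free resolution. -/
structure Syzygy (K : Type u) [Field K] (n : ℕ) where
  r : ℕ
  a : Fin r → ℤ
  Z : Submodule (Poly K n) (Fin r → Poly K n)
  homogeneous : (isGrading_freePiece a).IsHomogeneous Z

lemma Syzygy.exists_next (T : Syzygy K n) :
    ∃ (T' : Syzygy K n) (f : (Fin T'.r → Poly K n) →ₗ[Poly K n] (Fin T.r → Poly K n)),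
      IsHomogeneousMap (freePiece K n T'.a) (freePiece K n T.a) f ∧ LinearMap.range f = T.Z ∧
      T'.Z = LinearMap.ker f ∧
      T'.Z ≤ irrelevant K n • (⊤ : Submodule (Poly K n) (Fin T'.r → Poly K n)) := by
  obtain ⟨r, a, f, hf, hr, hk⟩ := (isGrading_freePiece T.a).exists_minimal_cover T.homogeneous
    (IsNoetherian.noetherian _)
  exact ⟨⟨r, a, LinearMap.ker f, (isGrading_freePiece a).isHomogeneous_ker
    (isGrading_freePiece T.a) hf⟩, f, hf, hr, rfl, hk⟩

theorem IsGrading.exists_minimal_resolution (h : IsGrading n ℳ) [Module.Finite (Poly K n) M] :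
    ∃ G : FreeResolution n ℳ, G.IsMinimal := by
  obtain ⟨r, a, f, hf, hr, hk⟩ := h.exists_minimal_cover h.isHomogeneous_top Module.Finite.fg_top
  choose next d hd hrange hker hmin using Syzygy.exists_next (K := K) (n := n)
  let T0 : Syzygy K n := ⟨r, a, LinearMap.ker f, (isGrading_freePiece a).isHomogeneous_ker h hf⟩
  let T : ℕ → Syzygy K n := fun i => Nat.rec T0 (fun _ T => next T) i
  refine ⟨{
    rank := fun i => (T i).r
    deg := fun i => (T i).a
    d := fun i => d (T i)
    aug := f
    d_homogeneous := fun i => hd (T i)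
    aug_homogeneous := hf
    exact := fun i => LinearMap.exact_iff.2 ((hker (T i)).symm.trans (hrange (T (i + 1))).symm)
    exact_aug := LinearMap.exact_iff.2 (hrange T0).symm
    aug_surjective := LinearMap.range_eq_top.1 hr }, ?_⟩
  rintro (_ | i)
  · exact (hrange T0).le.trans hk
  · exact (hrange (T (i + 1))).le.trans (hmin (T i))

end Minimal

/-! ### Regularity bounds the degrees of a module of finite length -/

section VarIdeal

variable {K : Type u} [Field K] {n : ℕ}

/-- The ideal generated by the first `q` variables. -/
def varIdeal (K : Type u) [Field K] (n q : ℕ) : Ideal (Poly K n) :=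
  Ideal.span (MvPolynomial.X '' {i : Fin n | (i : ℕ) < q})

lemma mem_varIdeal {q : ℕ} {p : Poly K n} :
    p ∈ varIdeal K n q ↔ ∀ m ∈ p.support, ∃ i : Fin n, (i : ℕ) < q ∧ m i ≠ 0 :=
  MvPolynomial.mem_ideal_span_X_image

lemma varIdeal_zero : varIdeal K n 0 = ⊥ := by
  simp [varIdeal]

lemma polyComp_mem_varIdeal {q : ℕ} {p : Poly K n} (hp : p ∈ varIdeal K n q) (d : ℤ) :
    polyComp K n d p ∈ varIdeal K n q := by
  rcases le_or_gt 0 d with hd | hd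
  · lift d to ℕ using hd
    rw [mem_varIdeal] at hp ⊢
    intro m hm
    rw [polyComp_natCast, MvPolynomial.support_homogeneousComponent] at hm
    exact hp m (Finset.mem_filter.1 hm).1
  · simp [polyComp, not_le.2 hd]

/-- A variable is a nonzerodivisor modulo the ideal generated by the previous ones. -/
lemma mem_varIdeal_of_X_mul_mem {q : ℕ} (hq : q < n) {p : Poly K n}
    (hp : MvPolynomial.X ⟨q, hq⟩ * p ∈ varIdeal K n q) : p ∈ varIdeal K n q := by
  rw [mem_varIdeal] at hp ⊢
  intro m hm
  obtain ⟨i, hi, hi'⟩ := hp (Finsupp.single ⟨q, hq⟩ 1 + m) (by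
    rw [MvPolynomial.mem_support_iff, MvPolynomial.coeff_X_mul]
    exact MvPolynomial.mem_support_iff.1 hm)
  refine ⟨i, hi, ?_⟩
  have hne : (⟨q, hq⟩ : Fin n) ≠ i := fun e => by
    subst e
    simp at hi
  simpa [Finsupp.single_apply, hne] using hi'

lemma mem_varIdeal_succ {q : ℕ} (hq : q < n) {p : Poly K n} :
    p ∈ varIdeal K n (q + 1) ↔
      ∃ a ∈ varIdeal K n q, ∃ b, p = a + MvPolynomial.X ⟨q, hq⟩ * b := by
  have : varIdeal K n (q + 1) = varIdeal K n q ⊔ Ideal.span {MvPolynomial.X ⟨q, hq⟩} := by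
    rw [varIdeal, varIdeal, ← Ideal.span_union, ← Set.image_singleton, ← Set.image_union]
    congr 2
    ext i
    simp only [Set.mem_ofPred_eq, Set.mem_union, Set.mem_singleton_iff, Fin.ext_iff]
    omega
  rw [this, Submodule.mem_sup]
  constructor
  · rintro ⟨a, ha, c, hc, rfl⟩
    obtain ⟨b, rfl⟩ := Ideal.mem_span_singleton'.1 hc
    exact ⟨a, ha, b, by rw [mul_comm]⟩
  · rintro ⟨a, ha, b, rfl⟩
    exact ⟨a, ha, _, Ideal.mem_span_singleton'.2 ⟨b, rfl⟩, by rw [mul_comm]⟩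

/-- The submodule `(x_1, …, x_q) S^r` of `S^r`. -/
def varSubmodule (K : Type u) [Field K] (n q r : ℕ) :
    Submodule (Poly K n) (Fin r → Poly K n) :=
  Submodule.pi Set.univ fun _ => varIdeal K n q

lemma mem_varSubmodule {q r : ℕ} {x : Fin r → Poly K n} :
    x ∈ varSubmodule K n q r ↔ ∀ s, x s ∈ varIdeal K n q := by
  simp [varSubmodule, Submodule.mem_pi]

lemma map_mem_varSubmodule {q r r' : ℕ} (f : (Fin r → Poly K n) →ₗ[Poly K n] (Fin r' → Poly K n))
    {x : Fin r → Poly K n} (hx : x ∈ varSubmodule K n q r) : f x ∈ varSubmodule K n q r' := by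
  rw [mem_varSubmodule] at hx ⊢
  intro s
  rw [LinearMap.pi_apply_eq_sum_univ f x, Finset.sum_apply]
  exact Submodule.sum_mem _ fun t _ => Ideal.mul_mem_right _ _ (hx t)

lemma mem_varSubmodule_of_X_smul_mem {q r : ℕ} (hq : q < n) {x : Fin r → Poly K n}
    (hx : (MvPolynomial.X ⟨q, hq⟩ : Poly K n) • x ∈ varSubmodule K n q r) :
    x ∈ varSubmodule K n q r := by
  rw [mem_varSubmodule] at hx ⊢
  exact fun s => mem_varIdeal_of_X_mul_mem hq (hx s)

lemma mem_varSubmodule_succ {q r : ℕ} (hq : q < n) {x : Fin r → Poly K n} :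
    x ∈ varSubmodule K n (q + 1) r ↔
      ∃ a ∈ varSubmodule K n q r, ∃ b, x = a + (MvPolynomial.X ⟨q, hq⟩ : Poly K n) • b := by
  simp only [mem_varSubmodule]
  constructor
  · intro h
    choose a ha b hb using fun s => (mem_varIdeal_succ hq).1 (h s)
    exact ⟨a, ha, b, funext hb⟩
  · rintro ⟨a, ha, b, rfl⟩ s
    exact (mem_varIdeal_succ hq).2 ⟨a s, ha s, b s, rfl⟩

lemma varSubmodule_zero (r : ℕ) : varSubmodule K n 0 r = ⊥ := by
  ext x
  simp [mem_varSubmodule, varIdeal_zero, funext_iff]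

lemma freePiece_proj_apply {r : ℕ} (a : Fin r → ℤ) (d : ℤ) (x : Fin r → Poly K n) (s : Fin r) :
    (isGrading_freePiece a).proj d x s = polyComp K n (d - a s) (x s) := by
  induction x using (isGrading_freePiece (K := K) (n := n) a).induction with
  | hom e x hx =>
    have h1 := mem_freePiece.1 hx s
    rcases eq_or_ne e d with rfl | hne
    · rw [(isGrading_freePiece a).proj_of_mem hx, polyComp_of_mem h1]
    · rw [(isGrading_freePiece a).proj_of_mem_of_ne hx hne,
        polyComp_of_mem_of_ne h1 (by omega), Pi.zero_apply]
  | add x y hx hy => simp only [map_add, Pi.add_apply, hx, hy]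

lemma proj_mem_varSubmodule {q r : ℕ} (a : Fin r → ℤ) (d : ℤ) {x : Fin r → Poly K n}
    (hx : x ∈ varSubmodule K n q r) :
    (isGrading_freePiece a).proj d x ∈ varSubmodule K n q r := by
  rw [mem_varSubmodule] at hx ⊢
  intro s
  rw [freePiece_proj_apply]
  exact polyComp_mem_varIdeal (hx s) _

lemma X_smul_mem {M : Type v} [AddCommGroup M] [Module K M] [Module (Poly K n) M]
    {ℳ : ℤ → Submodule K M} (h : IsGrading n ℳ) (i : Fin n) {d : ℤ} {x : M} (hx : x ∈ ℳ d) :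
    (MvPolynomial.X i : Poly K n) • x ∈ ℳ (d + 1) := by
  have := h.smul_mem 1 d (MvPolynomial.X i) x (MvPolynomial.isHomogeneous_X K i) hx
  rwa [add_comm d, show (1 : ℤ) = (1 : ℕ) from rfl]

end VarIdeal

section Socle

variable {K : Type u} [Field K] {n : ℕ}
variable {M : Type v} [AddCommGroup M] [Module K M] [Module (Poly K n) M]
variable {ℳ : ℤ → Submodule K M}

namespace FreeResolution

variable (G : FreeResolution n ℳ)

lemma d_d (p : ℕ) (x : Fin (G.rank (p + 2)) → Poly K n) : G.d p (G.d (p + 1) x) = 0 :=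
  (G.exact p).apply_apply_eq_zero x

/-- The `i`-th homology of `G ⊗ S/(x_1, …, x_q)` vanishes for `i > q`. -/
lemma mem_sup_range_of_d_mem (q : ℕ) (hq : q ≤ n) (p : ℕ) (hp : q ≤ p)
    (g : Fin (G.rank (p + 1)) → Poly K n) (hg : G.d p g ∈ varSubmodule K n q (G.rank p)) :
    g ∈ varSubmodule K n q (G.rank (p + 1)) ⊔ LinearMap.range (G.d (p + 1)) := by
  induction q generalizing p with
  | zero =>
    rw [varSubmodule_zero, Submodule.mem_bot] at hg
    exact Submodule.mem_sup_right ((G.exact p g).1 hg)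
  | succ q ih =>
    obtain ⟨p, rfl⟩ : ∃ p', p = p' + 1 := ⟨p - 1, by omega⟩
    obtain ⟨a, ha, b, hab⟩ := (mem_varSubmodule_succ (by omega : q < n)).1 hg
    have hb : G.d p b ∈ varSubmodule K n q (G.rank p) := by
      refine mem_varSubmodule_of_X_smul_mem (by omega : q < n) ?_
      have h1 := congrArg (G.d p) hab
      rw [G.d_d, map_add, map_smul] at h1
      rw [eq_neg_of_add_eq_zero_right h1.symm]
      exact neg_mem (map_mem_varSubmodule _ ha)
    obtain ⟨c, hc, _, ⟨y, rfl⟩, hcy⟩ := Submodule.mem_sup.1 (ih (by omega) p (by omega) b hb)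
    have h2 := ih (by omega) (p + 1) (by omega)
      (g - (MvPolynomial.X ⟨q, by omega⟩ : Poly K n) • y) (by
        rw [map_sub, map_smul, hab, ← hcy, smul_add, ← add_assoc, add_sub_cancel_right]
        exact add_mem ha (Submodule.smul_mem _ _ hc))
    obtain ⟨a', ha', z, hz, hsum⟩ := Submodule.mem_sup.1 h2
    refine Submodule.mem_sup.2 ⟨a' + (MvPolynomial.X ⟨q, by omega⟩ : Poly K n) • y,
      (mem_varSubmodule_succ (by omega : q < n)).2 ⟨a', ha', y, rfl⟩, z, hz, ?_⟩
    rw [add_right_comm a', hsum, sub_add_cancel]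

/-- A socle element of degree `e` of the resolved module is moved by the connecting maps for
multiplication by `x_1, …, x_q` to a nonzero socle element of degree `e + q` of the `q`-th homology
of `G ⊗ S/(x_1, …, x_q)`. -/
lemma exists_socle_class (h : IsGrading n ℳ) {e : ℤ} {x : M} (hx : x ∈ ℳ e) (hx0 : x ≠ 0)
    (hsoc : ∀ i : Fin n, (MvPolynomial.X i : Poly K n) • x = 0) (q : ℕ) (hq : q ≤ n) :
    ∃ g ∈ G.piece q (e + q),
      g ∉ varSubmodule K n q (G.rank q) ⊔ LinearMap.range (G.d q) ∧
      ∀ i : Fin n, (MvPolynomial.X i : Poly K n) • g ∈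
        varSubmodule K n q (G.rank q) ⊔ LinearMap.range (G.d q) := by
  induction q with
  | zero =>
    obtain ⟨g, hg, rfl⟩ := (isGrading_freePiece (G.deg 0)).exists_mem_of_mem_range h
      G.aug_homogeneous (LinearMap.range_eq_top.2 G.aug_surjective ▸ Submodule.mem_top) hx
    refine ⟨g, by
      rw [Nat.cast_zero, add_zero]
      exact hg, ?_, fun i => ?_⟩
    · rw [varSubmodule_zero, bot_sup_eq]
      exact fun hg' => hx0 ((G.exact_aug g).2 hg')
    · exact Submodule.mem_sup_right ((G.exact_aug _).1 (by rw [map_smul, hsoc]))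
  | succ q ih =>
    obtain ⟨g, hg, hnot, hs⟩ := ih (by omega)
    have hqn : q < n := by omega
    obtain ⟨a, ha, _, ⟨g', rfl⟩, hag⟩ := Submodule.mem_sup.1 (hs ⟨q, hqn⟩)
    -- the equation `X_q g = a + d g'` may be replaced by its part of degree `e + q + 1`
    have hdeg := X_smul_mem (isGrading_freePiece (G.deg q)) ⟨q, hqn⟩ hg
    have hproj := congrArg ((isGrading_freePiece (G.deg q)).proj (e + q + 1)) hag
    rw [map_add, (isGrading_freePiece (G.deg q)).proj_of_mem hdeg,
      ← (isGrading_freePiece (G.deg (q + 1))).map_proj (isGrading_freePiece (G.deg q))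
        (G.d_homogeneous q)] at hproj
    replace ha := proj_mem_varSubmodule (G.deg q) (e + q + 1) ha
    have hg' := (isGrading_freePiece (G.deg (q + 1))).proj_mem (e + q + 1) g'
    generalize (isGrading_freePiece (G.deg (q + 1))).proj (e + q + 1) g' = g₁ at hproj hg'
    generalize (isGrading_freePiece (G.deg q)).proj (e + q + 1) a = a₁ at hproj ha
    refine ⟨g₁, by
      rw [Nat.cast_add, Nat.cast_one, ← add_assoc]
      exact hg', fun hmem => ?_, fun i => ?_⟩
    · obtain ⟨c, hc, _, ⟨y, rfl⟩, hsum⟩ := Submodule.mem_sup.1 hmem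
      obtain ⟨a', ha', b, rfl⟩ := (mem_varSubmodule_succ hqn).1 hc
      have h1 : g - G.d q b ∈ varSubmodule K n q (G.rank q) := by
        refine mem_varSubmodule_of_X_smul_mem hqn ?_
        rw [smul_sub, ← hproj, ← hsum, map_add, map_add, G.d_d, map_smul, add_zero, ← add_assoc,
          add_sub_cancel_right]
        exact add_mem ha (map_mem_varSubmodule _ ha')
      exact hnot (Submodule.mem_sup.2 ⟨_, h1, _, ⟨b, rfl⟩, sub_add_cancel _ _⟩)
    · obtain ⟨c, hc, _, ⟨y, rfl⟩, hcy⟩ := Submodule.mem_sup.1 (hs i)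
      have h1 : G.d q ((MvPolynomial.X i : Poly K n) • g₁ -
          (MvPolynomial.X ⟨q, hqn⟩ : Poly K n) • y) ∈ varSubmodule K n q (G.rank q) := by
        have e1 : G.d q g₁ = (MvPolynomial.X ⟨q, hqn⟩ : Poly K n) • g - a₁ := by
          rw [← hproj, add_sub_cancel_left]
        have e2 : G.d q y = (MvPolynomial.X i : Poly K n) • g - c := by
          rw [← hcy, add_sub_cancel_left]
        rw [map_sub, map_smul, map_smul, e1, e2, smul_sub, smul_sub, smul_comm,
          sub_sub_sub_cancel_left]
        exact sub_mem (Submodule.smul_mem _ _ hc) (Submodule.smul_mem _ _ ha)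
      obtain ⟨a', ha', z, hz, hsum⟩ :=
        Submodule.mem_sup.1 (G.mem_sup_range_of_d_mem q (by omega) q le_rfl _ h1)
      refine Submodule.mem_sup.2 ⟨a' + (MvPolynomial.X ⟨q, hqn⟩ : Poly K n) • y,
        (mem_varSubmodule_succ hqn).2 ⟨a', ha', y, rfl⟩, z, hz, ?_⟩
      rw [add_right_comm a', hsum, sub_add_cancel]

/-- A socle element of degree `e` produces a generator of degree `e + n` in the `n`-th step of every
free resolution. -/
theorem betti_ne_zero_of_socle (h : IsGrading n ℳ) {e : ℤ} {x : M} (hx : x ∈ ℳ e) (hx0 : x ≠ 0)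
    (hsoc : ∀ i : Fin n, (MvPolynomial.X i : Poly K n) • x = 0) : G.betti n (e + n) ≠ 0 := by
  obtain ⟨g, hg, hnot, -⟩ := G.exists_socle_class h hx hx0 hsoc n le_rfl
  have h1 : g ∉ varSubmodule K n n (G.rank n) := fun h' => hnot (Submodule.mem_sup_left h')
  rw [mem_varSubmodule] at h1
  push Not at h1
  obtain ⟨s, hs⟩ := h1
  have h2 := mem_freePiece.1 hg s
  rw [betti, ← Nat.pos_iff_ne_zero, Fintype.card_pos_iff]
  refine ⟨⟨s, ?_⟩⟩
  by_contra hne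
  apply hs
  rw [mem_varIdeal]
  intro m hm
  by_contra! hcon
  have hm0 : m = 0 := Finsupp.ext fun i => hcon i i.2
  subst hm0
  rw [MvPolynomial.mem_support_iff] at hm
  apply hm
  have h3 := polyComp_of_mem_of_ne h2 (e := (0 : ℕ)) (by
    intro h0
    apply hne
    push_cast at h0
    linarith)
  rw [polyComp_natCast, MvPolynomial.homogeneousComponent_zero] at h3
  exact MvPolynomial.C_eq_zero.1 h3

end FreeResolution

/-- A graded module of finite length has a socle element in or above the degree of any given
nonzero homogeneous element. -/
lemma IsGrading.exists_socle (h : IsGrading n ℳ) [IsArtinian (Poly K n) M] {d : ℤ}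
    (hd : ℳ d ≠ ⊥) :
    ∃ e, d ≤ e ∧ ∃ x ∈ ℳ e, x ≠ 0 ∧ ∀ i : Fin n, (MvPolynomial.X i : Poly K n) • x = 0 := by
  by_contra! hcon
  have hpos : ∀ k : ℕ, ∃ x ∈ ℳ (d + k), x ≠ 0 := by
    intro k
    induction k with
    | zero =>
      obtain ⟨x, hx, hx0⟩ := (Submodule.ne_bot_iff _).1 hd
      exact ⟨x, by simpa using hx, hx0⟩
    | succ k ih =>
      obtain ⟨x, hx, hx0⟩ := ih
      obtain ⟨i, hi⟩ := hcon (d + k) (by omega) x hx hx0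
      refine ⟨_, ?_, hi⟩
      rw [Nat.cast_add, Nat.cast_one, ← add_assoc]
      exact X_smul_mem h i hx
  -- the submodules generated in degrees at least `d + k` form a strictly decreasing chain
  let Z : ℕ → Submodule (Poly K n) M := fun k =>
    Submodule.span (Poly K n) {x | ∃ j : ℕ, k ≤ j ∧ x ∈ ℳ (d + j)}
  have hanti : Antitone Z := fun a b hab =>
    Submodule.span_mono fun x ⟨j, hj, hx⟩ => ⟨j, hab.trans hj, hx⟩
  obtain ⟨k, hk⟩ := IsArtinian.monotone_stabilizes (R := Poly K n) (M := M)
    ⟨fun k => OrderDual.toDual (Z k), hanti⟩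
  have hk1 : Z k = Z (k + 1) := hk (k + 1) (by omega)
  obtain ⟨x, hx, hx0⟩ := hpos k
  have hxZ : x ∈ Z (k + 1) := by
    rw [← hk1]
    exact Submodule.subset_span ⟨k, le_rfl, hx⟩
  have hproj : ∀ y ∈ Z (k + 1), ∀ p : Poly K n, h.proj (d + k) (p • y) = 0 := by
    intro y hy
    induction hy using Submodule.span_induction with
    | mem y hy =>
      obtain ⟨j, hj, hy⟩ := hy
      intro p
      rw [h.proj_smul hy, polyComp, if_neg (by omega), LinearMap.zero_apply, zero_smul]
    | zero => simp
    | add y z _ _ hy hz =>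
      intro p
      rw [smul_add, map_add, hy, hz, add_zero]
    | smul q y _ hy =>
      intro p
      rw [smul_smul, hy]
  have h1 := hproj x hxZ 1
  rw [one_smul, h.proj_of_mem hx] at h1
  exact hx0 h1

/-- A graded module of finite length vanishes in degrees above its regularity. -/
theorem le_regularity_of_piece_ne_bot (h : IsGrading n ℳ)
    (hfin : IsFiniteLength (Poly K n) M) {d : ℤ} (hd : ℳ d ≠ ⊥) :
    ((d : ℝ) : EReal) ≤ regularity n ℳ := by
  obtain ⟨_, _⟩ := isFiniteLength_iff_isNoetherian_isArtinian.1 hfin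
  obtain ⟨e, hde, x, hx, hx0, hsoc⟩ := h.exists_socle hd
  obtain ⟨G, hG⟩ := h.exists_minimal_resolution
  refine le_trans ?_ (le_sSup ⟨G, hG, n, e + n, G.betti_ne_zero_of_socle h hx hx0 hsoc, rfl⟩)
  rw [add_sub_cancel_right]
  exact_mod_cast hde

/-- The resolution of a graded free module by itself. -/
def trivialResolution {r : ℕ} (a : Fin r → ℤ) : FreeResolution n (freePiece K n a) where
  rank i := i.casesOn r fun _ => 0
  deg i := match i with
    | 0 => a
    | _ + 1 => fun s => s.elim0
  d _ := 0
  aug := LinearMap.id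
  d_homogeneous _ _ _ _ := zero_mem _
  aug_homogeneous _ _ hx := hx
  exact _ _ := ⟨fun _ => ⟨0, Subsingleton.elim (α := Fin 0 → Poly K n) _ _⟩, fun _ => rfl⟩
  exact_aug _ := ⟨fun hx => ⟨0, hx.symm⟩, fun ⟨_, hy⟩ => hy.symm⟩
  aug_surjective := Function.surjective_id

theorem le_regularity_freePiece {r : ℕ} (a : Fin r → ℤ) (s : Fin r) :
    ((a s : ℝ) : EReal) ≤ regularity n (freePiece K n a) := by
  refine le_sSup ⟨trivialResolution a, ?_, 0, a s, ?_, ?_⟩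
  · rintro i _ ⟨x, rfl⟩
    exact zero_mem _
  · rw [FreeResolution.betti, ← Nat.pos_iff_ne_zero, Fintype.card_pos_iff]
    exact ⟨⟨s, rfl⟩⟩
  · simp

end Socle

/-! ### Dimensions of products, cohomology and tensor products -/

section Dimensions

variable {K : Type u} [Field K]

/-- A product of submodules, as a submodule, is the product of the submodules as modules. -/
def piSubmoduleEquiv {ι : Type*} {V : Type*} [AddCommGroup V] [Module K V]
    (p : ι → Submodule K V) : Submodule.pi Set.univ p ≃ₗ[K] ∀ s, p s where
  toFun x s := ⟨x.1 s, x.2 s trivial⟩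
  invFun x := ⟨fun s => x s, fun s _ => (x s).2⟩
  map_add' _ _ := rfl
  map_smul' _ _ := rfl

instance finiteDimensional_pi {ι : Type*} [Finite ι] {V : Type*} [AddCommGroup V]
    [Module K V] (p : ι → Submodule K V) [∀ s, FiniteDimensional K (p s)] :
    FiniteDimensional K (Submodule.pi Set.univ p) :=
  Module.Finite.equiv (piSubmoduleEquiv p).symm

lemma finrank_pi_submodule {ι : Type*} [Fintype ι] {V : Type*} [AddCommGroup V] [Module K V]
    (p : ι → Submodule K V) [∀ s, FiniteDimensional K (p s)] :
    Module.finrank K (Submodule.pi Set.univ p) = ∑ s, Module.finrank K (p s) := by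
  rw [(piSubmoduleEquiv p).finrank_eq, Module.finrank_pi_fintype]

end Dimensions

section Tensor

variable {K : Type u} [Field K] {n : ℕ}
variable {N : Type w} [AddCommGroup N] [Module (Poly K n) N]

/-- The identification `S^r ⊗ N ≃ N^r`. -/
def freeTensorEquiv (n : ℕ) [Module (Poly K n) N] (r : ℕ) :
    (Fin r → Poly K n) ⊗[Poly K n] N ≃ₗ[Poly K n] (Fin r → N) :=
  TensorProduct.comm (Poly K n) _ _ ≪≫ₗ
    TensorProduct.piScalarRight (Poly K n) (Poly K n) N (Fin r)

lemma freeTensorEquiv_tmul {r : ℕ} (f : Fin r → Poly K n) (y : N) (s : Fin r) :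
    freeTensorEquiv n r (f ⊗ₜ[Poly K n] y) s = f s • y := by
  simp [freeTensorEquiv, TensorProduct.piScalarRight_apply]

variable [Module K N] {𝒩 : ℤ → Submodule K N}

lemma IsGrading.smul_mem_of_mem_polyPiece (h : IsGrading n 𝒩) {d e : ℤ} {p : Poly K n} {y : N}
    (hp : p ∈ polyPiece K n d) (hy : y ∈ 𝒩 e) : p • y ∈ 𝒩 (d + e) := by
  have := h.proj_smul hy (d + e) p
  rw [add_sub_cancel_right, polyComp_of_mem hp] at this
  rw [← this]
  exact h.proj_mem _ _

variable [IsScalarTower K (Poly K n) N]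

/-- The degree `0` part of `(⊕ S(-a s)) ⊗ N` is `⊕ N_{-a s}`. -/
lemma map_tensorPiece (h : IsGrading n 𝒩) {r : ℕ} (a : Fin r → ℤ) :
    (tensorPiece n (freePiece K n a) 𝒩 0).map
      ((freeTensorEquiv n r).toLinearMap.restrictScalars K) =
        Submodule.pi Set.univ fun s => 𝒩 (-a s) := by
  apply le_antisymm
  · rw [Submodule.map_le_iff_le_comap, tensorPiece, Submodule.span_le]
    rintro _ ⟨c, d, x, y, hcd, hx, hy, rfl⟩ s -
    have h1 := h.smul_mem_of_mem_polyPiece (mem_freePiece.1 hx s) hy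
    rw [show c - a s + d = -a s by omega] at h1
    rw [LinearMap.restrictScalars_apply, LinearEquiv.coe_coe, freeTensorEquiv_tmul]
    exact h1
  · intro z hz
    refine ⟨∑ s, Pi.single s 1 ⊗ₜ[Poly K n] z s, ?_, ?_⟩
    · refine Submodule.sum_mem _ fun s _ => Submodule.subset_span
        ⟨a s, -a s, _, _, add_neg_cancel _, single_mem_freePiece ?_, hz s trivial, rfl⟩
      rw [sub_self]
      exact one_mem_polyPiece
    · rw [LinearMap.restrictScalars_apply, LinearEquiv.coe_coe, map_sum]
      ext t
      rw [Finset.sum_apply, Finset.sum_eq_single t, freeTensorEquiv_tmul, Pi.single_eq_same,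
        one_smul]
      · intro s _ hs
        rw [freeTensorEquiv_tmul, Pi.single_eq_of_ne hs.symm, zero_smul]
      · simp

theorem hilbert_tensorPiece (h : IsGrading n 𝒩) [∀ d, FiniteDimensional K (𝒩 d)] {r : ℕ}
    (a : Fin r → ℤ) :
    hilbert (tensorPiece n (freePiece K n a) 𝒩) 0 = ∑ s, hilbert 𝒩 (-a s) := by
  simp only [hilbert]
  rw [← finrank_pi_submodule, ← map_tensorPiece h a]
  exact (Submodule.equivMapOfInjective ((freeTensorEquiv n r).toLinearMap.restrictScalars K)
    (freeTensorEquiv n r).injective _).finrank_eq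

end Tensor

namespace FreeComplex

variable {K : Type u} [Field K] {n : ℕ} (E : FreeComplex K n)

instance (j : ℕ) (d : ℤ) : FiniteDimensional K (E.piece j d) :=
  inferInstanceAs (FiniteDimensional K (freePiece K n (E.deg j) d))

lemma isGrading_piece (j : ℕ) : IsGrading n (E.piece j) := isGrading_freePiece _

lemma isHomogeneous_cocycles (j : ℕ) : (E.isGrading_piece j).IsHomogeneous (E.cocycles j) :=
  (E.isGrading_piece j).isHomogeneous_ker (E.isGrading_piece (j + 1)) (E.d_homogeneous j)

lemma isHomogeneous_coboundaries (j : ℕ) :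
    (E.isGrading_piece j).IsHomogeneous (E.coboundaries j) := by
  cases j with
  | zero => exact IsGrading.isHomogeneous_bot _
  | succ j =>
    exact IsGrading.isHomogeneous_range (f := E.d j) (E.isGrading_piece j)
      (E.isGrading_piece (j + 1)) (E.d_homogeneous j)

theorem isGrading_HPiece (j : ℕ) : IsGrading n (E.HPiece j) := by
  have h := (E.isGrading_piece j).submodule (E.isHomogeneous_cocycles j)
  refine h.quotient fun x hx d => ?_
  have h1 := h.map_proj (E.isGrading_piece j) (f := (E.cocycles j).subtype)
    (fun _ _ hx => hx) d x
  change (E.cocycles j).subtype _ ∈ E.coboundaries j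
  rw [h1]
  exact E.isHomogeneous_coboundaries j _ hx d

/-- The coboundaries of degree `d`. -/
def boundPiece : ∀ (j : ℕ) (_ : ℤ), Submodule K (Fin (E.rank j) → Poly K n)
  | 0, _ => ⊥
  | j + 1, d => (E.piece j d).map ((E.d j).restrictScalars K)

/-- The cocycles of degree `d`. -/
def cycPiece (j : ℕ) (d : ℤ) : Submodule K (Fin (E.rank j) → Poly K n) :=
  E.piece j d ⊓ LinearMap.ker ((E.d j).restrictScalars K)

instance (j : ℕ) (d : ℤ) : FiniteDimensional K (E.cycPiece j d) :=
  Submodule.finiteDimensional_of_le (inf_le_left : E.cycPiece j d ≤ E.piece j d)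

instance (j : ℕ) (d : ℤ) : FiniteDimensional K (E.boundPiece j d) := by
  cases j with
  | zero =>
    change FiniteDimensional K (⊥ : Submodule K (Fin (E.rank 0) → Poly K n))
    infer_instance
  | succ j =>
    change FiniteDimensional K ((E.piece j d).map ((E.d j).restrictScalars K))
    infer_instance

/-- Every coboundary of degree `d` is the differential of an element of degree `d`. -/
lemma mem_boundPiece {j : ℕ} {d : ℤ} {x : Fin (E.rank j) → Poly K n} :
    x ∈ E.boundPiece j d ↔ x ∈ E.piece j d ∧ x ∈ E.coboundaries j := by
  cases j with
  | zero =>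
    change x = 0 ↔ _ ∧ x = 0
    constructor
    · rintro rfl
      exact ⟨zero_mem _, rfl⟩
    · exact fun h => h.2
  | succ j =>
    constructor
    · rintro ⟨y, hy, rfl⟩
      exact ⟨E.d_homogeneous j d y hy, y, rfl⟩
    · rintro ⟨hx, hx'⟩
      exact (E.isGrading_piece j).exists_mem_of_mem_range (E.isGrading_piece (j + 1))
        (E.d_homogeneous j) hx' hx

lemma coboundaries_le_cocycles (j : ℕ) : E.coboundaries j ≤ E.cocycles j := by
  cases j with
  | zero => exact bot_le
  | succ j =>
    rintro _ ⟨y, rfl⟩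
    exact LinearMap.congr_fun (E.d_comp_d j) y

instance finiteDimensional_comap_cocycles (j : ℕ) (d : ℤ) : FiniteDimensional K
    ↥((E.piece j d).comap ((E.cocycles j).subtype.restrictScalars K)) := by
  have : FiniteDimensional K (((E.piece j d).comap
      ((E.cocycles j).subtype.restrictScalars K)).map
        ((E.cocycles j).subtype.restrictScalars K)) :=
    Submodule.finiteDimensional_of_le (Submodule.map_comap_le _ (E.piece j d))
  exact Module.Finite.equiv (Submodule.equivMapOfInjective
    ((E.cocycles j).subtype.restrictScalars K) (E.cocycles j).injective_subtype _).symm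

instance finiteDimensional_HPiece (j : ℕ) (d : ℤ) : FiniteDimensional K (E.HPiece j d) := by
  unfold HPiece
  infer_instance

lemma gamma_eq (j : ℕ) (d : ℤ) :
    (E.gamma j d : ℤ) = Module.finrank K (E.cycPiece j d) - Module.finrank K (E.boundPiece j d) := by
  have h1 := finrank_map_add_finrank_inf_ker
    ((E.piece j d).comap ((E.cocycles j).subtype.restrictScalars K))
    (((E.coboundaries j).submoduleOf (E.cocycles j)).mkQ.restrictScalars K)
  have hinj : Function.Injective ((E.cocycles j).subtype.restrictScalars K) :=
    (E.cocycles j).injective_subtype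
  rw [(Submodule.equivMapOfInjective _ hinj
      ((E.piece j d).comap ((E.cocycles j).subtype.restrictScalars K))).finrank_eq,
    (Submodule.equivMapOfInjective _ hinj
      ((E.piece j d).comap ((E.cocycles j).subtype.restrictScalars K) ⊓ _)).finrank_eq] at h1
  have e1 : ((E.piece j d).comap ((E.cocycles j).subtype.restrictScalars K)).map
      ((E.cocycles j).subtype.restrictScalars K) = E.cycPiece j d := by
    ext x
    constructor
    · rintro ⟨y, hy, rfl⟩
      exact ⟨hy, y.2⟩
    · rintro ⟨hx, hx'⟩
      exact ⟨⟨x, hx'⟩, hx, rfl⟩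
  have e2 : ((E.piece j d).comap ((E.cocycles j).subtype.restrictScalars K) ⊓
      LinearMap.ker (((E.coboundaries j).submoduleOf (E.cocycles j)).mkQ.restrictScalars K)).map
        ((E.cocycles j).subtype.restrictScalars K) = E.boundPiece j d := by
    ext x
    rw [mem_boundPiece]
    constructor
    · rintro ⟨y, ⟨hy, hy'⟩, rfl⟩
      exact ⟨hy, (Submodule.Quotient.mk_eq_zero ((E.coboundaries j).submoduleOf _)).1 hy'⟩
    · rintro ⟨hx, hx'⟩
      exact ⟨⟨x, E.coboundaries_le_cocycles j hx'⟩,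
        ⟨hx, (Submodule.Quotient.mk_eq_zero ((E.coboundaries j).submoduleOf _)).2 hx'⟩, rfl⟩
  rw [e1, e2] at h1
  replace h1 : E.gamma j d + Module.finrank K (E.boundPiece j d) =
    Module.finrank K (E.cycPiece j d) := h1
  omega

lemma cycPiece_le_boundPiece {j : ℕ} {d : ℤ} (h : E.HPiece j d = ⊥) :
    E.cycPiece j d ≤ E.boundPiece j d := by
  rintro x ⟨hx, hx'⟩
  rw [mem_boundPiece]
  refine ⟨hx, ?_⟩
  have h1 : ((E.coboundaries j).submoduleOf (E.cocycles j)).mkQ ⟨x, hx'⟩ ∈ E.HPiece j d :=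
    ⟨⟨x, hx'⟩, hx, rfl⟩
  rw [h, Submodule.mem_bot] at h1
  exact (Submodule.Quotient.mk_eq_zero ((E.coboundaries j).submoduleOf _)).1 h1

end FreeComplex

/-! ### The double complex of a resolution and a free complex -/

section Double

variable {K : Type u} [Field K] {n : ℕ}

/-- The map `f ⊗ N : N^r → N^{r'}` induced by a map `f : S^r → S^{r'}` of free modules. -/
def freeMap {r r' : ℕ} (f : (Fin r → Poly K n) →ₗ[Poly K n] (Fin r' → Poly K n))
    (N : Type w) [AddCommGroup N] [Module (Poly K n) N] :
    (Fin r → N) →ₗ[Poly K n] (Fin r' → N) :=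
  LinearMap.pi fun s => ∑ t, f (fun t' => if t = t' then 1 else 0) s • LinearMap.proj t

lemma freeMap_apply {r r' : ℕ} (f : (Fin r → Poly K n) →ₗ[Poly K n] (Fin r' → Poly K n))
    {N : Type w} [AddCommGroup N] [Module (Poly K n) N] (x : Fin r → N) (s : Fin r') :
    freeMap f N x s = ∑ t, f (fun t' => if t = t' then 1 else 0) s • x t := by
  simp [freeMap]

lemma freeMap_comm {r r' : ℕ} (f : (Fin r → Poly K n) →ₗ[Poly K n] (Fin r' → Poly K n))
    {N N' : Type*} [AddCommGroup N] [Module (Poly K n) N] [AddCommGroup N'] [Module (Poly K n) N']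
    (g : N →ₗ[Poly K n] N') (x : Fin r → N) :
    g.compLeft (Fin r') (freeMap f N x) = freeMap f N' (g.compLeft (Fin r) x) := by
  ext s
  simp [freeMap_apply, LinearMap.compLeft_apply]

/-- On `N = S^e` the map `f ⊗ N` is `f` applied to each of the `e` columns. -/
lemma freeMap_pi_apply {r r' e : ℕ} (f : (Fin r → Poly K n) →ₗ[Poly K n] (Fin r' → Poly K n))
    (x : Fin r → Fin e → Poly K n) (s : Fin r') (t : Fin e) :
    freeMap f (Fin e → Poly K n) x s t = f (fun s' => x s' t) s := by
  rw [freeMap_apply, LinearMap.pi_apply_eq_sum_univ f, Finset.sum_apply, Finset.sum_apply]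
  exact Finset.sum_congr rfl fun i _ => mul_comm _ _

variable {M : Type v} [AddCommGroup M] [Module K M] [Module (Poly K n) M]
variable {ℳ : ℤ → Submodule K M} (F : FreeResolution n ℳ) (E : FreeComplex K n)

/-- The degree `0` part of `F_i ⊗ E^j`. -/
def tensorZero (i j : ℕ) : Submodule K (Fin (F.rank i) → Fin (E.rank j) → Poly K n) :=
  Submodule.pi Set.univ fun s => E.piece j (-F.deg i s)

lemma mem_tensorZero {i j : ℕ} {x : Fin (F.rank i) → Fin (E.rank j) → Poly K n} :
    x ∈ tensorZero F E i j ↔ ∀ s, x s ∈ E.piece j (-F.deg i s) := by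
  simp [tensorZero, Submodule.mem_pi]

lemma mem_tensorZero' {i j : ℕ} {x : Fin (F.rank i) → Fin (E.rank j) → Poly K n} :
    x ∈ tensorZero F E i j ↔ ∀ t, (fun s => x s t) ∈ F.piece i (-E.deg j t) := by
  simp only [mem_tensorZero, FreeComplex.piece, FreeResolution.piece, mem_freePiece]
  rw [forall_comm]
  refine forall_congr' fun t => forall_congr' fun s => ?_
  rw [neg_sub_comm]

/-- An element of `(F_i ⊗ E^j)_0` all of whose columns are boundaries of `F` is a boundary of
`(F ⊗ E^j)_0`. -/
lemma exists_freeMap_eq {i j : ℕ} {x : Fin (F.rank i) → Fin (E.rank j) → Poly K n}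
    (hx : x ∈ tensorZero F E i j) (h : ∀ t, (fun s => x s t) ∈ LinearMap.range (F.d i)) :
    ∃ y ∈ tensorZero F E (i + 1) j, freeMap (F.d i) (Fin (E.rank j) → Poly K n) y = x := by
  rw [mem_tensorZero'] at hx
  choose y hy hyx using fun t => (isGrading_freePiece (F.deg (i + 1))).exists_mem_of_mem_range
    (isGrading_freePiece (F.deg i)) (F.d_homogeneous i) (h t) (hx t)
  refine ⟨fun s t => y t s, (mem_tensorZero' F E).2 hy, ?_⟩
  ext1 s
  ext1 t
  rw [freeMap_pi_apply]
  exact congrFun (hyx t) s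

/-- The degree `0` part of the double complex `F ⊗ E`. -/
def tensorDouble : DoubleComplex.{u, u} K where
  X i j := Fin (F.rank i) → Fin (E.rank j) → Poly K n
  A i j := tensorZero F E i j
  finite i j := finiteDimensional_pi _
  dh i j := (freeMap (F.d i) (Fin (E.rank j) → Poly K n)).restrictScalars K
  dv i j := ((E.d j).compLeft (Fin (F.rank i))).restrictScalars K
  dh_mem i j x hx := by
    rw [mem_tensorZero'] at hx ⊢
    intro t
    have : (fun s => freeMap (F.d i) (Fin (E.rank j) → Poly K n) x s t) =
        F.d i (fun s => x s t) := funext fun s => freeMap_pi_apply _ _ _ _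
    exact this ▸ F.d_homogeneous i _ _ (hx t)
  dv_mem i j x hx := by
    rw [mem_tensorZero] at hx ⊢
    exact fun s => E.d_homogeneous j _ _ (hx s)
  comm i j x := freeMap_comm (F.d i) (E.d j) x
  dv_dv i j x := funext fun s => LinearMap.congr_fun (E.d_comp_d j) (x s)
  dh_dh i j x := by
    ext1 s
    ext1 t
    simp only [LinearMap.restrictScalars_apply, freeMap_pi_apply]
    exact congrFun (F.d_d i _) s
  exact i j x hx h0 := by
    refine exists_freeMap_eq F E hx fun t => (F.exact i _).1 ?_
    ext1 s
    rw [← freeMap_pi_apply]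
    exact congrFun (congrFun h0 s) t

lemma tensorDouble_cyc (i j : ℕ) :
    (tensorDouble F E).cyc i j = Submodule.pi Set.univ fun s => E.cycPiece j (-F.deg i s) := by
  ext x
  constructor
  · rintro ⟨hx, hx'⟩ s -
    exact ⟨(mem_tensorZero F E).1 hx s, congrFun hx' s⟩
  · intro hx
    exact ⟨(mem_tensorZero F E).2 fun s => (hx s trivial).1, funext fun s => (hx s trivial).2⟩

lemma tensorDouble_bound (i j : ℕ) :
    (tensorDouble F E).bound i j =
      Submodule.pi Set.univ fun s => E.boundPiece j (-F.deg i s) := by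
  ext x
  cases j with
  | zero =>
    exact ⟨fun hx s _ => congrFun (show x = 0 from hx) s, fun hx => funext fun s => hx s trivial⟩
  | succ j =>
    constructor
    · rintro ⟨y, hy, rfl⟩ s -
      exact ⟨y s, (mem_tensorZero F E).1 hy s, rfl⟩
    · intro hx
      choose y hy hyx using fun s => hx s trivial
      exact ⟨y, (mem_tensorZero F E).2 hy, funext hyx⟩

lemma tensorDouble_h (i j : ℕ) :
    (tensorDouble F E).h i j = ∑ s, (E.gamma j (-F.deg i s) : ℤ) := by
  have h1 : Module.finrank K ((tensorDouble F E).cyc i j) =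
      ∑ s, Module.finrank K (E.cycPiece j (-F.deg i s)) := by
    rw [tensorDouble_cyc]
    exact finrank_pi_submodule fun s => E.cycPiece j (-F.deg i s)
  have h2 : Module.finrank K ((tensorDouble F E).bound i j) =
      ∑ s, Module.finrank K (E.boundPiece j (-F.deg i s)) := by
    rw [tensorDouble_bound]
    exact finrank_pi_submodule fun s => E.boundPiece j (-F.deg i s)
  simp only [DoubleComplex.h, h1, h2, E.gamma_eq, Finset.sum_sub_distrib, Nat.cast_sum]

lemma tensorDouble_A_eq_bot {i : ℕ} (hi : F.rank i = 0) (j : ℕ) :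
    (tensorDouble F E).A i j = ⊥ := by
  rw [eq_bot_iff]
  intro x _
  change x = 0
  funext s
  exact (Fin.cast hi s).elim0

lemma tensorDouble_h_eq_zero {i : ℕ} (hi : F.rank i = 0) (j : ℕ) :
    (tensorDouble F E).h i j = 0 := by
  rw [tensorDouble_h]
  exact Finset.sum_eq_zero fun s _ => (Fin.cast hi s).elim0

/-! ### The pairing -/

/-- A sum weighted by the Betti numbers of `F_i` is a sum over the generators of `F_i`. -/
lemma finsum_betti_mul (i : ℕ) (f : ℤ → ℤ) :
    ∑ᶠ k : ℤ, (F.betti i k : ℤ) * f k = ∑ s, f (F.deg i s) := by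
  classical
  rw [finsum_eq_sum_of_support_subset (s := Finset.univ.image (F.deg i))]
  · rw [Finset.sum_comp f (F.deg i)]
    refine Finset.sum_congr rfl fun k _ => ?_
    rw [FreeResolution.betti, Fintype.card_subtype, nsmul_eq_mul]
  · intro k hk
    have h1 : F.betti i k ≠ 0 := fun h => hk (by simp [h])
    rw [FreeResolution.betti, ← Nat.pos_iff_ne_zero, Fintype.card_pos_iff] at h1
    obtain ⟨s, hs⟩ := h1
    simpa using ⟨s, hs⟩

lemma pairing_eq : pairing F E =
    ∑ᶠ (j : ℕ) (i : ℕ), if j ≤ i then (-1 : ℤ) ^ (i - j) * (tensorDouble F E).h i j else 0 := by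
  refine finsum_congr fun j => finsum_congr fun i => ?_
  split_ifs with hij
  · rw [tensorDouble_h, ← finsum_betti_mul F i fun k => (E.gamma j (-k) : ℤ)]
    simp only [mul_assoc]
    rw [← smul_eq_mul, smul_finsum]
    rfl
  · exact finsum_zero

lemma truncatedEuler_eq (j : ℕ) : truncatedEuler F E j =
    ∑ᶠ i : ℕ, if j ≤ i then (-1 : ℤ) ^ (i - j) * (tensorDouble F E).h i j else 0 := by
  refine finsum_congr fun i => ?_
  rw [FreeResolution.piece, hilbert_tensorPiece (E.isGrading_HPiece j), tensorDouble_h]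
  push_cast
  rfl

lemma pairing_eq_sum {L : ℕ} (hL : ∀ i, L < i → F.rank i = 0) : pairing F E =
    ∑ i ∈ Finset.range (L + 1), ∑ j ∈ Finset.range (i + 1),
      (-1 : ℤ) ^ (i - j) * (tensorDouble F E).h i j := by
  have h0 : ∀ i j, L < i →
      (if j ≤ i then (-1 : ℤ) ^ (i - j) * (tensorDouble F E).h i j else 0) = 0 := by
    intro i j hi
    rw [tensorDouble_h_eq_zero F E (hL i hi), mul_zero, ite_self]
  have h1 : ∀ j, (∑ᶠ i : ℕ, if j ≤ i then (-1 : ℤ) ^ (i - j) * (tensorDouble F E).h i j else 0) =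
      ∑ i ∈ Finset.range (L + 1),
        if j ≤ i then (-1 : ℤ) ^ (i - j) * (tensorDouble F E).h i j else 0 := fun j => by
    refine finsum_eq_sum_of_support_subset _ fun i hi => ?_
    by_contra hcon
    exact hi (h0 i j (by simpa using hcon))
  rw [pairing_eq]
  simp only [h1]
  rw [finsum_eq_sum_of_support_subset (s := Finset.range (L + 1)), Finset.sum_comm]
  · refine Finset.sum_congr rfl fun i hi => ?_
    rw [← Finset.sum_filter]
    congr 1
    ext j
    simp only [Finset.mem_filter, Finset.mem_range] at hi ⊢
    omega
  · intro j hj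
    by_contra hcon
    refine hj (Finset.sum_eq_zero fun i hi => if_neg ?_)
    simp only [Finset.coe_range, Set.mem_Iio, Finset.mem_range] at hcon hi
    omega

/-- The degree `0` part `⊕ₛ N_{-a s}` of `(⊕ₛ S(-a s)) ⊗ N` vanishes if the regularities of the two
factors have negative sum. Both regularities are bounded below by integers if some `N_{-a s}` is
nonzero, so the convention `⊥ + ⊤ = ⊥` plays no role. -/
lemma pieces_eq_bot_of_regularity_add_lt {N : Type w} [AddCommGroup N] [Module K N]
    [Module (Poly K n) N] {𝒩 : ℤ → Submodule K N} (h : IsGrading n 𝒩)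
    (hfin : IsFiniteLength (Poly K n) N) {r : ℕ} (a : Fin r → ℤ)
    (hreg : regularity n (freePiece K n a) + regularity n 𝒩 < 0) (s : Fin r) :
    𝒩 (-a s) = ⊥ := by
  by_contra hne
  have h1 := add_le_add (le_regularity_freePiece (K := K) (n := n) a s)
    (le_regularity_of_piece_ne_bot h hfin hne)
  rw [← EReal.coe_add, Int.cast_neg, add_neg_cancel, EReal.coe_zero] at h1
  exact absurd hreg (not_lt.2 h1)

end Double

end BoijSoderberg

end

open BoijSoderberg in
theorem mainTheorem7 {K : Type*} [Field K] (n : ℕ)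
    (E : FreeComplex K n) (hE : ∀ i, n < i → E.rank i = 0)
    {M : Type*} [AddCommGroup M] [Module K M] [Module (Poly K n) M] [IsScalarTower K (Poly K n) M]
    (ℳ : ℤ → Submodule K M) (hℳ : IsGrading n ℳ)
    (F : FreeResolution n ℳ) (hF : ∃ l : ℕ, ∀ i, l < i → F.rank i = 0) :
    pairing F E = ∑ᶠ j : ℕ, truncatedEuler F E j ∧
    0 ≤ pairing F E ∧
    (IsFiniteLength (Poly K n) M →
      (∀ j, 0 < j → IsFiniteLength (Poly K n) (E.H j)) →
      regularity n ℳ + regularity n (E.piece 0) < 0 →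
      (∀ j, 0 < j → regularity n (F.piece (j - 1)) + regularity n (E.HPiece j) < 0) →
      pairing F E = 0) := by
  obtain ⟨l, hl⟩ := hF
  have hsum := pairing_eq_sum F E (L := l + 1) fun i hi => hl i (by omega)
  have hbot : ∀ i, l + 1 < i + 1 → ∀ j, (tensorDouble F E).A i j = ⊥ := fun i hi j =>
    tensorDouble_A_eq_bot F E (hl i (by omega)) j
  refine ⟨?_, ?_, fun hM hH hreg0 hreg => ?_⟩
  · rw [pairing_eq]
    exact finsum_congr fun j => (truncatedEuler_eq F E j).symm
  · rw [hsum]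
    exact (tensorDouble F E).sum_h_nonneg _ hbot
  · rw [hsum]
    refine (tensorDouble F E).sum_h_eq_zero _ hbot ?_ fun p => ?_
    · intro x hx
      obtain ⟨y, hy, hyx⟩ := exists_freeMap_eq F E hx fun t => (F.exact_aug _).1 (by
        have h1 := F.aug_homogeneous _ _ ((mem_tensorZero' F E).1 hx t)
        rw [add_comm] at hreg0
        rwa [pieces_eq_bot_of_regularity_add_lt hℳ hM (E.deg 0) hreg0 t, Submodule.mem_bot] at h1)
      exact ⟨y, hy, hyx⟩
    · rw [tensorDouble_cyc, tensorDouble_bound]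
      intro x hx s _
      exact E.cycPiece_le_boundPiece (pieces_eq_bot_of_regularity_add_lt
        (E.isGrading_HPiece (p + 1)) (hH _ p.succ_pos) (F.deg p) (hreg _ p.succ_pos) s)
          (hx s trivial)
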